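/- **Theorem 2 (Low-distortion Embedding for $\ell_1$).** For positive integers $s,n$ let $\Pi = SC \in \mathbb{R}^{s\times n}$, where $S\in\mathbb{R}^{s\times n}$ has each column chosen independently and uniformly from the $s$ standard basis vectors of $\mathbb{R}^s$, and $C\in\mathbb{R}^{n\times n}$ is a diagonal matrix, independent of $S$, whose diagonal entries are independent standard Cauchy random variables. Let $\log$ denote the natural logarithm, and let $\operatorname{nnz}(A)$ denote the number of nonzero entries of $A$. (a) There is an absolute constant $\omega_0$ such that for every $\omega\ge\omega_0$ there are constants $C_1,C_2>0$, depending only on $\omega$, such that for all $n$, all $d\ge 2$ and all $A\in\mathbb{R}^{n\times d}$ with full column rank, if $s=\lceil \omega\, d^5\log^5 d\rceil$, then with probability at least $1/2$, $$\frac{1}{C_1\, d^2\log^2 d}\,\|Ax\|_1\;\le\;\|\Pi A x\|_1\;\le\; C_2\, d\log d\,\|Ax\|_1\qquad\text{for all } x\in\mathbb{R}^d .$$ (b) In addition, $\Pi A$ can be computed in $O(\operatorname{nnz}(A))$ time: there are a single program for the real RAM (a random access machine with unit-cost operations on natural-number indices and on real numbers, and with zero-initialized memory) and an absolute constant $K$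 such that for all $n$, $s$, all $d \geq 1$, every $A\in\mathbb{R}^{n\times d}$ with full column rank and every realization of $\Pi=SC$, the program halts within $K\cdot\operatorname{nnz}(A)$ steps with the $s \times d$ matrix $\Pi A$ in its memory, when it is given $A$ as a list, in any order, of the triplets (row, column, value) of its nonzero entries, and $\Pi$ as the array of the positions of the ones in the columns of $S$ together with the array of the diagonal entries of $C$. -/

import Mathlib

open MeasureTheory ProbabilityTheory
open scoped Matrix

noncomputable section

namespace SparseCauchy

/-- The `ℓ₁` norm of a real vector. -/
abbrev l1Norm {m : ℕ} (v : Fin m → ℝ) : ℝ := ‖WithLp.toLp 1 v‖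

/-- The matrix `S ∈ ℝ^{s × n}` whose `j`-th column is the standard basis vector `e_{h j}`. -/
def hashMatrix {s n : ℕ} (h : Fin n → Fin s) : Matrix (Fin s) (Fin n) ℝ :=
  Matrix.of fun i j => if h j = i then 1 else 0

/-- The embedding matrix `Π = S C`, with `S` the hashing matrix of `h` and `C = diag(c)`. -/
def embeddingMatrix {s n : ℕ} (h : Fin n → Fin s) (c : Fin n → ℝ) : Matrix (Fin s) (Fin n) ℝ :=
  hashMatrix h * Matrix.diagonal c

/-- The joint law of `(h, c)`: all `h j` uniform on `Fin s`, all `c j` standard Cauchy, and all of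
them mutually independent. -/
def sketchLaw (s n : ℕ) : Measure ((Fin n → Fin s) × (Fin n → ℝ)) :=
  (Measure.pi fun _ : Fin n => uniformOn (Set.univ : Set (Fin s))).prod
    (Measure.pi fun _ : Fin n => cauchyMeasure 0 1)

/-- The embedding dimension `s = ω d⁵ log⁵ d`, rounded up to an integer. -/
def embeddingDim (ω : ℝ) (d : ℕ) : ℕ := ⌈ω * (d : ℝ) ^ 5 * Real.log d ^ 5⌉₊

/-- The number of nonzero entries of a matrix. -/
def nnz {n d : ℕ} (A : Matrix (Fin n) (Fin d) ℝ) : ℕ :=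
  {p : Fin n × Fin d | A p.1 p.2 ≠ 0}.ncard

end SparseCauchy

/-! ### The real RAM

A random access machine with unit cost instructions. It has registers and a random access memory
for natural numbers (indices), and registers and a random access memory for real numbers. -/

namespace RealRAM

/-- Instructions. Below, `I` are the index registers, `M` is the index memory, `R` are the real
registers and `X` is the real memory. -/
inductive Instr : Type
  /-- `I[r] := k` -/
  | const (r k : ℕ)
  /-- `I[r] := I[a] + I[b]` -/
  | add (r a b : ℕ)
  /-- `I[r] := I[a] - I[b]` (zero if negative) -/
  | sub (r a b : ℕ)
  /-- `I[r] := I[a] * I[b]` -/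
  | mul (r a b : ℕ)
  /-- `I[r] := M[I[a]]` -/
  | load (r a : ℕ)
  /-- `M[I[a]] := I[r]` -/
  | store (a r : ℕ)
  /-- if `I[a] < I[b]`, go to instruction `l` -/
  | jumpLt (a b l : ℕ)
  /-- `R[r] := k` -/
  | rconst (r : ℕ) (k : ℤ)
  /-- `R[r] := R[a] + R[b]` -/
  | radd (r a b : ℕ)
  /-- `R[r] := R[a] - R[b]` -/
  | rsub (r a b : ℕ)
  /-- `R[r] := R[a] * R[b]` -/
  | rmul (r a b : ℕ)
  /-- `R[r] := R[a] / R[b]` -/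
  | rdiv (r a b : ℕ)
  /-- `R[r] := X[I[a]]` -/
  | rload (r a : ℕ)
  /-- `X[I[a]] := R[r]` -/
  | rstore (a r : ℕ)
  /-- if `R[a] < R[b]`, go to instruction `l` -/
  | rjumpLt (a b l : ℕ)

/-- A program is a finite list of instructions, numbered from `0`. -/
abbrev Program : Type := List Instr

/-- A configuration of the machine. -/
structure State : Type where
  /-- number of the next instruction -/
  pc : ℕ
  /-- index registers -/
  I : ℕ → ℕ
  /-- index memory -/
  M : ℕ → ℕ
  /-- real registers -/
  R : ℕ → ℝ
  /-- real memory -/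
  X : ℕ → ℝ

/-- The effect of one instruction. -/
def exec (σ : State) : Instr → State
  | .const r k => { σ with pc := σ.pc + 1, I := Function.update σ.I r k }
  | .add r a b => { σ with pc := σ.pc + 1, I := Function.update σ.I r (σ.I a + σ.I b) }
  | .sub r a b => { σ with pc := σ.pc + 1, I := Function.update σ.I r (σ.I a - σ.I b) }
  | .mul r a b => { σ with pc := σ.pc + 1, I := Function.update σ.I r (σ.I a * σ.I b) }
  | .load r a => { σ with pc := σ.pc + 1, I := Function.update σ.I r (σ.M (σ.I a)) }
  | .store a r => { σ with pc := σ.pc + 1, M := Function.update σ.M (σ.I a) (σ.I r) }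
  | .jumpLt a b l => { σ with pc := if σ.I a < σ.I b then l else σ.pc + 1 }
  | .rconst r k => { σ with pc := σ.pc + 1, R := Function.update σ.R r (k : ℝ) }
  | .radd r a b => { σ with pc := σ.pc + 1, R := Function.update σ.R r (σ.R a + σ.R b) }
  | .rsub r a b => { σ with pc := σ.pc + 1, R := Function.update σ.R r (σ.R a - σ.R b) }
  | .rmul r a b => { σ with pc := σ.pc + 1, R := Function.update σ.R r (σ.R a * σ.R b) }
  | .rdiv r a b => { σ with pc := σ.pc + 1, R := Function.update σ.R r (σ.R a / σ.R b) }
  | .rload r a => { σ with pc := σ.pc + 1, R := Function.update σ.R r (σ.X (σ.I a)) }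
  | .rstore a r => { σ with pc := σ.pc + 1, X := Function.update σ.X (σ.I a) (σ.R r) }
  | .rjumpLt a b l => { σ with pc := if σ.R a < σ.R b then l else σ.pc + 1 }

/-- The machine has halted when there is no next instruction. -/
def Halted (P : Program) (σ : State) : Prop := P.length ≤ σ.pc

/-- One step of the machine, at unit cost; a halted machine does nothing. -/
def step (P : Program) (σ : State) : State :=
  match P[σ.pc]? with
  | some i => exec σ i
  | none => σ

/-- The configuration after `t` steps. -/
def run (P : Program) (t : ℕ) (σ : State) : State := (step P)^[t] σ

end RealRAM

namespace SparseCauchy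

open RealRAM

/-- `L` lists the positions of the nonzero entries of `A`, each once, in some order. -/
def IsSupportList {n d : ℕ} (A : Matrix (Fin n) (Fin d) ℝ) (L : List (Fin n × Fin d)) : Prop :=
  L.Nodup ∧ ∀ p : Fin n × Fin d, p ∈ L ↔ A p.1 p.2 ≠ 0

/-- The input: `A` in coordinate (triplet) format along the list `L`, and `Π = S C` through the
array of the row numbers `h j` of its column entries and the array of their values `c j`.
Registers `0`, `1`, `2`, `3` hold `n`, `d`, `s` and the number of triplets; the index memory holds
the row numbers, then the column numbers of the triplets, then `h`; the real memory holds the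
values of the triplets, then `c`. All else is zero. -/
def inputState {n d s : ℕ} (A : Matrix (Fin n) (Fin d) ℝ) (L : List (Fin n × Fin d))
    (h : Fin n → Fin s) (c : Fin n → ℝ) : State where
  pc := 0
  I := fun r => [n, d, s, L.length].getD r 0
  M := fun a =>
    (L.map (fun p => (p.1 : ℕ)) ++ L.map (fun p => (p.2 : ℕ)) ++
      List.ofFn (fun j => (h j : ℕ))).getD a 0
  R := fun _ => 0
  X := fun a => (L.map (fun p => A p.1 p.2) ++ List.ofFn c).getD a 0

/-- The real memory contains the matrix `B`, row by row, from address `base` on. -/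
def HoldsMatrix {s d : ℕ} (σ : State) (base : ℕ) (B : Matrix (Fin s) (Fin d) ℝ) : Prop :=
  ∀ (i : Fin s) (k : Fin d), σ.X (base + ((i : ℕ) * d + (k : ℕ))) = B i k

/-- Within `T` steps the program `P` halts on the input `A`, `Π = S C`, with the matrix `Π A` in the
real memory, directly behind the input. -/
def ComputesProductWithin (P : Program) (T : ℕ) {n d s : ℕ} (A : Matrix (Fin n) (Fin d) ℝ)
    (L : List (Fin n × Fin d)) (h : Fin n → Fin s) (c : Fin n → ℝ) : Prop :=
  ∃ t ≤ T, Halted P (run P t (inputState A L h c)) ∧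
    HoldsMatrix (run P t (inputState A L h c)) (L.length + n) (embeddingMatrix h c * A)

end SparseCauchy

end

noncomputable section

namespace SparseCauchy

section CauchyDistribution

open Real FourierTransform

lemma integrable_exp_neg_two_pi_abs :
    Integrable (fun t : ℝ => (Real.exp (-(2 * π * |t|)) : ℂ)) := by
  have hIoi : IntegrableOn (fun t : ℝ => Real.exp (-(2 * π * |t|))) (Set.Ioi 0) := by
    refine (integrableOn_exp_mul_Ioi (a := -(2 * π)) (by simp [pi_pos]) 0).congr_fun ?_
      measurableSet_Ioi
    intro t ht
    simp [abs_of_pos (Set.mem_Ioi.1 ht)]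
  have hIic : IntegrableOn (fun t : ℝ => Real.exp (-(2 * π * |t|))) (Set.Iic 0) := by
    refine (integrableOn_exp_mul_Iic (a := 2 * π) (by simp [pi_pos]) 0).congr_fun ?_
      measurableSet_Iic
    intro t ht
    simp [abs_of_nonpos (Set.mem_Iic.1 ht)]
  have h : Integrable (fun t : ℝ => Real.exp (-(2 * π * |t|))) := by
    rw [← integrableOn_univ, ← Set.Iic_union_Ioi (a := (0 : ℝ))]
    exact hIic.union hIoi
  exact h.ofReal

lemma fourier_exp_neg_two_pi_abs (x : ℝ) :
    𝓕 (fun t : ℝ => (Real.exp (-(2 * π * |t|)) : ℂ)) x = (cauchyPDFReal 0 1 x : ℂ) := by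
  have hpi : (π : ℂ) ≠ 0 := by exact_mod_cast pi_ne_zero
  rw [Real.fourier_eq']
  have hint : Integrable (fun t : ℝ => Complex.exp (↑(-2 * π * inner ℝ t x) * Complex.I) •
      (Real.exp (-(2 * π * |t|)) : ℂ)) := by
    refine integrable_exp_neg_two_pi_abs.mono (by fun_prop) (ae_of_all _ fun t => ?_)
    rw [norm_smul, Complex.norm_exp_ofReal_mul_I, one_mul]
  rw [← integral_add_compl (measurableSet_Iic (a := (0 : ℝ))) hint, Set.compl_Iic]
  have h1 : ∫ t in Set.Iic (0 : ℝ), Complex.exp (↑(-2 * π * inner ℝ t x) * Complex.I) •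
      (Real.exp (-(2 * π * |t|)) : ℂ)
      = ∫ t in Set.Iic (0 : ℝ), Complex.exp ((2 * π - 2 * π * x * Complex.I) * t) := by
    refine setIntegral_congr_fun measurableSet_Iic fun t ht => ?_
    simp only [abs_of_nonpos (Set.mem_Iic.1 ht)]
    push_cast
    rw [smul_eq_mul, ← Complex.exp_add]
    congr 1
    simp
    ring
  have h2 : ∫ t in Set.Ioi (0 : ℝ), Complex.exp (↑(-2 * π * inner ℝ t x) * Complex.I) •
      (Real.exp (-(2 * π * |t|)) : ℂ)
      = ∫ t in Set.Ioi (0 : ℝ), Complex.exp ((-(2 * π) - 2 * π * x * Complex.I) * t) := by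
    refine setIntegral_congr_fun measurableSet_Ioi fun t ht => ?_
    simp only [abs_of_pos (Set.mem_Ioi.1 ht)]
    push_cast
    rw [smul_eq_mul, ← Complex.exp_add]
    congr 1
    simp
    ring
  rw [h1, h2, integral_exp_mul_complex_Iic (by simp [pi_pos]),
    integral_exp_mul_complex_Ioi (by simp [pi_pos])]
  have e1 : (1 : ℂ) - x * Complex.I ≠ 0 := fun h => by simpa using congrArg Complex.re h
  have e2 : (1 : ℂ) + x * Complex.I ≠ 0 := fun h => by simpa using congrArg Complex.re h
  have e3 : (x : ℂ) ^ 2 + 1 ≠ 0 := by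
    have : (x ^ 2 + 1 : ℝ) ≠ 0 := by positivity
    exact_mod_cast this
  have f1 : (2 * π - 2 * π * x * Complex.I : ℂ) = 2 * π * (1 - x * Complex.I) := by ring
  have f2 : (-(2 * π) - 2 * π * x * Complex.I : ℂ) = -(2 * π * (1 + x * Complex.I)) := by ring
  rw [f1, f2, cauchyPDFReal_def]
  push_cast
  simp only [mul_zero, Complex.exp_zero, sub_zero, one_pow, mul_one]
  have key : (1 - x * Complex.I) * (1 + x * Complex.I) = (x : ℂ) ^ 2 + 1 := by
    ring_nf
    simp
  rw [← key]
  field_simp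
  ring

lemma integral_cauchyMeasure {E : Type*} [NormedAddCommGroup E] [NormedSpace ℝ E] (f : ℝ → E) :
    ∫ x, f x ∂(cauchyMeasure 0 1) = ∫ x, cauchyPDFReal 0 1 x • f x := by
  rw [cauchyMeasure_of_scale_ne_zero _ one_ne_zero, integral_withDensity_eq_integral_toReal_smul
    (by fun_prop) (ae_of_all _ fun x => by simp [cauchyPDF])]
  simp [cauchyPDF, ENNReal.toReal_ofReal (cauchyPDF_pos 0 one_ne_zero _).le]

/-- The characteristic function of the standard Cauchy distribution. -/
lemma charFun_cauchyMeasure (t : ℝ) :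
    charFun (cauchyMeasure 0 1) t = (Real.exp (-|t|) : ℂ) := by
  set f : ℝ → ℂ := fun t => (Real.exp (-(2 * π * |t|)) : ℂ) with hf
  have hF : 𝓕 f = fun x => (cauchyPDFReal 0 1 x : ℂ) := funext fourier_exp_neg_two_pi_abs
  have hcont : Continuous f := by fun_prop
  have hinv := congrFun (hcont.fourierInv_fourier_eq integrable_exp_neg_two_pi_abs
    (by rw [hF]; exact (integrable_cauchyPDFReal 0).ofReal)) (t / (2 * π))
  rw [hF, Real.fourierInv_eq'] at hinv
  rw [charFun_apply_real, integral_cauchyMeasure]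
  convert hinv using 1
  · refine integral_congr_ae (ae_of_all _ fun x => ?_)
    simp only [Complex.real_smul, smul_eq_mul]
    rw [mul_comm]
    congr 3
    push_cast
    simp
    have hpi : (π : ℂ) ≠ 0 := by exact_mod_cast pi_ne_zero
    field_simp
  · simp only [hf, abs_div, abs_of_pos two_pi_pos]
    congr 2
    field_simp

lemma cauchyMeasure_real_apply {S : Set ℝ} (hS : MeasurableSet S) :
    (cauchyMeasure 0 1).real S = ∫ x in S, cauchyPDFReal 0 1 x := by
  have := integral_cauchyMeasure (fun x => S.indicator (1 : ℝ → ℝ) x)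
  rw [integral_indicator_one hS] at this
  rw [this, ← integral_indicator hS]
  congr with x
  by_cases hx : x ∈ S <;> simp [hx]

lemma cauchyPDFReal_le_inv_pi (x : ℝ) : cauchyPDFReal 0 1 x ≤ π⁻¹ := by
  rw [cauchyPDFReal_def]
  have : ((x - 0) ^ 2 + ((1 : NNReal) : ℝ) ^ 2)⁻¹ ≤ 1 := by
    apply inv_le_one_of_one_le₀
    simp
    positivity
  have h0 : 0 ≤ π⁻¹ := by positivity
  calc _ ≤ π⁻¹ * ((1 : NNReal) : ℝ) * 1 := by gcongr
    _ = _ := by simp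

/-- Anti-concentration of the Cauchy distribution at the origin. -/
lemma cauchyMeasure_abs_lt_le {u : ℝ} (hu : 0 ≤ u) :
    (cauchyMeasure 0 1).real {x | |x| < u} ≤ u := by
  have hset : {x : ℝ | |x| < u} = Set.Ioo (-u) u := by ext x; simp [abs_lt]
  rw [hset, cauchyMeasure_real_apply measurableSet_Ioo]
  calc ∫ x in Set.Ioo (-u) u, cauchyPDFReal 0 1 x
      ≤ ∫ x in Set.Ioo (-u) u, π⁻¹ := by
        refine setIntegral_mono (integrable_cauchyPDFReal 0).integrableOn ?_
          (fun x => cauchyPDFReal_le_inv_pi x)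
        exact integrableOn_const (by simp)
    _ = 2 * u * π⁻¹ := by simp [hu]; ring
    _ ≤ 2 * u * 2⁻¹ := by gcongr; exact two_le_pi
    _ = u := by ring

/-- The tail of the Cauchy distribution. -/
lemma cauchyMeasure_lt_abs_le {u : ℝ} (hu : 0 < u) :
    (cauchyMeasure 0 1).real {x | u < |x|} ≤ u⁻¹ := by
  have hIoi : (cauchyMeasure 0 1).real (Set.Ioi u) ≤ 2⁻¹ * u⁻¹ := by
    rw [cauchyMeasure_real_apply measurableSet_Ioi]
    have hint : IntegrableOn (fun x : ℝ => 2⁻¹ * x ^ (-2 : ℝ)) (Set.Ioi u) :=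
      (integrableOn_Ioi_rpow_of_lt (by norm_num) hu).const_mul _
    calc ∫ x in Set.Ioi u, cauchyPDFReal 0 1 x
        ≤ ∫ x in Set.Ioi u, 2⁻¹ * x ^ (-2 : ℝ) := by
          refine setIntegral_mono_on (integrable_cauchyPDFReal 0).integrableOn hint
            measurableSet_Ioi fun x hx => ?_
          have hx0 : 0 < x := hu.trans hx
          rw [cauchyPDFReal_def, rpow_neg hx0.le]
          norm_cast
          simp only [mul_one, sub_zero, one_pow]
          gcongr
          · exact two_le_pi
          · linarith
      _ = _ := by
          rw [integral_const_mul, integral_Ioi_rpow_of_lt (by norm_num) hu]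
          norm_num [rpow_neg_one]
  have hIio : (cauchyMeasure 0 1).real (Set.Iio (-u)) = (cauchyMeasure 0 1).real (Set.Ioi u) := by
    rw [cauchyMeasure_real_apply measurableSet_Ioi, cauchyMeasure_real_apply measurableSet_Iio,
      ← integral_Iic_eq_integral_Iio, ← integral_comp_neg_Ioi]
    simp [cauchyPDFReal_def]
  have hset : {x : ℝ | u < |x|} = Set.Iio (-u) ∪ Set.Ioi u := by
    ext x
    simp only [lt_abs, Set.mem_ofPred_eq, Set.mem_union, Set.mem_Iio, Set.mem_Ioi]
    constructor
    · rintro (h | h)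
      · exact Or.inr h
      · exact Or.inl (by linarith)
    · rintro (h | h)
      · exact Or.inr (by linarith)
      · exact Or.inl h
  rw [hset]
  refine (measureReal_union_le _ _).trans ?_
  rw [hIio]
  linarith

end CauchyDistribution

section LinearForms

variable {ι κ : Type*} [Fintype ι] [Fintype κ]

/-- The law of finitely many independent standard Cauchy variables. -/
abbrev cauchyPi (ι : Type*) [Fintype ι] : Measure (ι → ℝ) :=
  Measure.pi fun _ : ι => cauchyMeasure 0 1

lemma integral_exp_sum_cauchyPi (b : ι → ℝ) :
    ∫ c : ι → ℝ, Complex.exp (((∑ j, c j * b j : ℝ) : ℂ) * Complex.I) ∂cauchyPi ι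
      = ((Real.exp (-∑ j, |b j|) : ℝ) : ℂ) := by
  have h : ∀ c : ι → ℝ, Complex.exp (((∑ j, c j * b j : ℝ) : ℂ) * Complex.I)
      = ∏ j, Complex.exp (b j * c j * Complex.I) := by
    intro c
    rw [← Complex.exp_sum]
    congr 1
    push_cast
    rw [Finset.sum_mul]
    exact Finset.sum_congr rfl fun j _ => by ring
  simp_rw [h]
  rw [integral_fintype_prod_eq_prod (fun j (x : ℝ) => Complex.exp (b j * x * Complex.I))]
  simp_rw [← charFun_apply_real, charFun_cauchyMeasure]
  rw [← Finset.sum_neg_distrib, Real.exp_sum]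
  push_cast
  rfl

/-- Stability of the Cauchy distribution. -/
lemma map_linear_cauchyPi (a : ι → ℝ) :
    (cauchyPi ι).map (fun c => ∑ j, c j * a j)
      = (cauchyMeasure 0 1).map ((∑ j, |a j|) * ·) := by
  have hm : Measurable fun c : ι → ℝ => ∑ j, c j * a j := by fun_prop
  have := Measure.isProbabilityMeasure_map (μ := cauchyPi ι) hm.aemeasurable
  have := Measure.isProbabilityMeasure_map (μ := cauchyMeasure 0 1)
    (f := ((∑ j, |a j|) * ·)) (by fun_prop)
  refine Measure.ext_of_charFun (funext fun t => ?_)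
  rw [charFun_map_mul, charFun_cauchyMeasure, charFun_apply_real,
    integral_map hm.aemeasurable (by fun_prop)]
  convert integral_exp_sum_cauchyPi (fun j => a j * t) using 3
  · congr 2
    push_cast
    rw [Finset.mul_sum]
    exact Finset.sum_congr rfl fun j _ => by ring
  · rw [abs_mul, abs_of_nonneg (Finset.sum_nonneg fun j _ => abs_nonneg (a j)), Finset.sum_mul]
    simp [abs_mul]

/-- Sums of Cauchy variables over disjoint buckets are independent Cauchy variables, with the sums
of the scales. -/
lemma map_bucketSums_cauchyPi [DecidableEq κ] (h : ι → κ) (y : ι → ℝ) :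
    (cauchyPi ι).map (fun c i => ∑ j with h j = i, c j * y j)
      = Measure.pi fun i => (cauchyMeasure 0 1).map ((∑ j with h j = i, |y j|) * ·) := by
  have hm : Measurable fun (c : ι → ℝ) (i : κ) => ∑ j with h j = i, c j * y j := by fun_prop
  have := Measure.isProbabilityMeasure_map (μ := cauchyPi ι) hm.aemeasurable
  have : ∀ i, IsProbabilityMeasure
      ((cauchyMeasure 0 1).map ((∑ j with h j = i, |y j|) * ·)) := fun i =>
    Measure.isProbabilityMeasure_map (by fun_prop)
  refine charFun_eq_pi_iff.1 fun t => ?_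
  simp_rw [charFun_map_mul, charFun_cauchyMeasure]
  rw [charFun_apply, integral_map (by fun_prop) (by fun_prop),
    integral_map hm.aemeasurable (by fun_prop)]
  convert integral_exp_sum_cauchyPi (fun j => y j * t (h j)) using 3
  · congr 3
    rw [PiLp.inner_apply]
    simp only [RCLike.inner_apply, conj_trivial]
    rw [← Finset.sum_fiberwise (s := Finset.univ) (g := h)]
    refine Finset.sum_congr rfl fun i _ => ?_
    rw [Finset.mul_sum]
    refine Finset.sum_congr rfl fun j hj => ?_
    rw [← (Finset.mem_filter.1 hj).2]
    ring
  · rw [← Complex.ofReal_prod, ← Real.exp_sum, Finset.sum_neg_distrib]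
    congr 3
    rw [← Finset.sum_fiberwise (s := Finset.univ) (g := h) (f := fun j => |y j * t (h j)|)]
    refine Finset.sum_congr rfl fun i _ => ?_
    rw [abs_mul, abs_of_nonneg (Finset.sum_nonneg fun j _ => abs_nonneg (y j)), Finset.sum_mul]
    refine Finset.sum_congr rfl fun j hj => ?_
    rw [← (Finset.mem_filter.1 hj).2, abs_mul]

end LinearForms

section TruncatedMoments

lemma min_abs_two_pow_le (x : ℝ) (k : ℕ) :
    min |x| (2 ^ k) ≤ 1 + ∑ i ∈ Finset.range k, {z : ℝ | (2 : ℝ) ^ i < |z|}.indicator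
      (fun _ => (2 : ℝ) ^ i) x := by
  induction k with
  | zero => simp
  | succ k ih =>
    rw [Finset.sum_range_succ]
    have : min |x| (2 ^ (k + 1)) ≤ min |x| (2 ^ k) + {z : ℝ | (2 : ℝ) ^ k < |z|}.indicator
      (fun _ => (2 : ℝ) ^ k) x := by
      by_cases hx : (2 : ℝ) ^ k < |x|
      · rw [Set.indicator_of_mem (by exact hx), min_eq_right hx.le]
        refine (min_le_right _ _).trans ?_
        rw [pow_succ]; linarith
      · rw [Set.indicator_of_notMem (by exact hx), min_eq_left (not_lt.1 hx), add_zero]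
        exact min_le_left _ _
    linarith

lemma measurableSet_lt_abs (u : ℝ) : MeasurableSet {z : ℝ | u < |z|} :=
  measurableSet_lt measurable_const (by fun_prop)

lemma integrable_min_abs (T : ℝ) (μ : Measure ℝ) [IsFiniteMeasure μ] :
    Integrable (fun x : ℝ => min |x| T) μ := by
  refine Integrable.of_bound (C := |T|) (by fun_prop) (ae_of_all _ fun x => ?_)
  rw [Real.norm_eq_abs]
  rcases min_choice |x| T with h | h
  · rw [h, abs_abs]
    exact (min_eq_left_iff.1 h).trans (le_abs_self T)
  · rw [h]

/-- The expectation of the Cauchy distribution truncated at level `2 ^ k`. -/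
lemma integral_min_abs_two_pow_le (k : ℕ) :
    ∫ x, min |x| (2 ^ k) ∂(cauchyMeasure 0 1) ≤ 1 + k := by
  have hint : ∀ i : ℕ, Integrable ({z : ℝ | (2 : ℝ) ^ i < |z|}.indicator
      (fun _ => (2 : ℝ) ^ i)) (cauchyMeasure 0 1) := fun i =>
    (integrable_const _).indicator (measurableSet_lt_abs _)
  calc ∫ x, min |x| (2 ^ k) ∂(cauchyMeasure 0 1)
      ≤ ∫ x, (1 + ∑ i ∈ Finset.range k, {z : ℝ | (2 : ℝ) ^ i < |z|}.indicator
          (fun _ => (2 : ℝ) ^ i) x) ∂(cauchyMeasure 0 1) := by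
        refine integral_mono (integrable_min_abs _ _) ?_ fun x => min_abs_two_pow_le x k
        exact (integrable_const _).add (integrable_finsetSum _ fun i _ => hint i)
    _ = 1 + ∑ i ∈ Finset.range k, (cauchyMeasure 0 1).real {z : ℝ | (2 : ℝ) ^ i < |z|} * 2 ^ i := by
        rw [integral_add (integrable_const _) (integrable_finsetSum _ fun i _ => hint i),
          integral_finsetSum _ fun i _ => hint i]
        congr 1
        · simp
        · exact Finset.sum_congr rfl fun i _ => by
            rw [integral_indicator_const _ (measurableSet_lt_abs _), smul_eq_mul]
    _ ≤ 1 + ∑ i ∈ Finset.range k, (1 : ℝ) := by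
        gcongr with i _
        calc _ ≤ ((2 : ℝ) ^ i)⁻¹ * 2 ^ i := by
              gcongr
              exact cauchyMeasure_lt_abs_le (by positivity)
          _ = 1 := by field_simp
    _ = 1 + k := by simp

lemma quarter_le_integral_min_abs : 1 / 4 ≤ ∫ x, min |x| 1 ∂(cauchyMeasure 0 1) := by
  have hS : MeasurableSet {z : ℝ | |z| < 1 / 2} := measurableSet_lt (by fun_prop) measurable_const
  have hle : ∀ x : ℝ, {z : ℝ | |z| < 1 / 2}ᶜ.indicator (fun _ => (1 / 2 : ℝ)) x ≤ min |x| 1 := by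
    intro x
    by_cases hx : |x| < 1 / 2
    · rw [Set.indicator_of_notMem (by simpa using hx)]
      positivity
    · rw [Set.indicator_of_mem (by exact hx)]
      exact le_min (not_lt.1 hx) (by norm_num)
  have := integral_mono (μ := cauchyMeasure 0 1)
    ((integrable_const _).indicator hS.compl) (integrable_min_abs 1 _) hle
  rw [integral_indicator_const _ hS.compl, probReal_compl_eq_one_sub hS, smul_eq_mul] at this
  have h2 := cauchyMeasure_abs_lt_le (u := 1 / 2) (by norm_num)
  linarith

lemma exp_neg_le_quadratic {x : ℝ} (hx : 0 ≤ x) : Real.exp (-x) ≤ 1 - x + x ^ 2 / 2 := by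
  have h := Real.quadratic_le_exp_of_nonneg hx
  have hpos : 0 < 1 + x + x ^ 2 / 2 := by positivity
  rw [Real.exp_neg]
  refine (inv_anti₀ hpos h).trans ?_
  rw [inv_le_iff_one_le_mul₀ hpos]
  nlinarith [sq_nonneg (x ^ 2)]

/-- The Laplace transform of `|c|` for a standard Cauchy variable `c`. -/
lemma integral_exp_neg_mul_abs_le {t : ℝ} (ht : 0 ≤ t) :
    ∫ x, Real.exp (-(t * |x|)) ∂(cauchyMeasure 0 1) ≤ Real.exp (-(t / 4) + t ^ 2 / 2) := by
  have hpt : ∀ x : ℝ, Real.exp (-(t * |x|)) ≤ 1 - t * min |x| 1 + t ^ 2 / 2 := by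
    intro x
    have hm0 : 0 ≤ min |x| 1 := by positivity
    have hm1 : min |x| 1 ≤ 1 := min_le_right _ _
    have h1 : Real.exp (-(t * |x|)) ≤ Real.exp (-(t * min |x| 1)) := by
      gcongr
      exact min_le_left _ _
    refine h1.trans ((exp_neg_le_quadratic (by positivity)).trans ?_)
    have : (t * min |x| 1) ^ 2 ≤ t ^ 2 := by
      gcongr
      nlinarith
    linarith
  have hint := (integrable_min_abs 1 (cauchyMeasure 0 1)).const_mul t
  calc ∫ x, Real.exp (-(t * |x|)) ∂(cauchyMeasure 0 1)
      ≤ ∫ x, (1 - t * min |x| 1 + t ^ 2 / 2) ∂(cauchyMeasure 0 1) := by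
        refine integral_mono ?_ (((integrable_const _).sub hint).add (integrable_const _)) hpt
        refine Integrable.of_bound (C := 1) (by fun_prop) (ae_of_all _ fun x => ?_)
        rw [Real.norm_eq_abs, Real.abs_exp, Real.exp_le_one_iff]
        have : 0 ≤ t * |x| := by positivity
        linarith
    _ = 1 - t * ∫ x, min |x| 1 ∂(cauchyMeasure 0 1) + t ^ 2 / 2 := by
        have hsub : Integrable (fun x : ℝ => 1 - t * min |x| 1) (cauchyMeasure 0 1) :=
          (integrable_const _).sub hint
        rw [integral_add hsub (integrable_const _),
          integral_sub (integrable_const _) hint, integral_const_mul]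
        simp
    _ ≤ -(t / 4) + t ^ 2 / 2 + 1 := by nlinarith [quarter_le_integral_min_abs]
    _ ≤ _ := Real.add_one_le_exp _

end TruncatedMoments

section Tails

variable {ι κ : Type*} [Fintype ι] [Fintype κ]

/-- Upper tail of the `ℓ₁` norm of a vector of arbitrarily dependent Cauchy variables. -/
lemma cauchyPi_sum_abs_ge_le (a : κ → ι → ℝ) {g t : ℝ} (hg : 0 < g)
    (hag : ∑ i, ∑ j, |a i j| ≤ g) (ht : 0 < t) (k : ℕ) :
    (cauchyPi ι).real {c | t * g ≤ ∑ i, |∑ j, c j * a i j|}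
      ≤ Fintype.card κ / 2 ^ k + (1 + k) / t := by
  set γ : κ → ℝ := fun i => ∑ j, |a i j| with hγ
  have hγ0 : ∀ i, 0 ≤ γ i := fun i => Finset.sum_nonneg fun j _ => abs_nonneg _
  set X : κ → (ι → ℝ) → ℝ := fun i c => ∑ j, c j * a i j with hX
  have hXm : ∀ i, Measurable (X i) := fun i => by fun_prop
  have hlaw : ∀ i, (cauchyPi ι).map (X i) = (cauchyMeasure 0 1).map (γ i * ·) :=
    fun i => map_linear_cauchyPi (a i)
  set Y : (ι → ℝ) → ℝ := fun c => ∑ i, min |X i c| (γ i * 2 ^ k) with hY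
  have hbig : ∀ i, (cauchyPi ι).real {c | γ i * 2 ^ k < |X i c|} ≤ 1 / 2 ^ k := by
    intro i
    have e1 : (cauchyPi ι).real {c | γ i * 2 ^ k < |X i c|}
        = ((cauchyPi ι).map (X i)).real {x | γ i * 2 ^ k < |x|} := by
      rw [map_measureReal_apply (hXm i) (measurableSet_lt_abs _)]
      rfl
    rw [e1, hlaw, map_measureReal_apply (by fun_prop) (measurableSet_lt_abs _), one_div]
    refine le_trans (measureReal_mono fun x hx => ?_)
      (cauchyMeasure_lt_abs_le (u := 2 ^ k) (by positivity))
    have hx' : γ i * 2 ^ k < |γ i * x| := hx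
    rw [abs_mul, abs_of_nonneg (hγ0 i)] at hx'
    exact lt_of_mul_lt_mul_left hx' (hγ0 i)
  have hYi : ∀ i, ∫ c, min |X i c| (γ i * 2 ^ k) ∂(cauchyPi ι) ≤ γ i * (1 + k) := by
    intro i
    have e1 : ∫ c, min |X i c| (γ i * 2 ^ k) ∂(cauchyPi ι)
        = ∫ x, min |x| (γ i * 2 ^ k) ∂((cauchyPi ι).map (X i)) := by
      rw [integral_map (hXm i).aemeasurable (by fun_prop)]
    rw [e1, hlaw, integral_map (by fun_prop) (by fun_prop)]
    have e2 : ∀ x : ℝ, min |γ i * x| (γ i * 2 ^ k) = γ i * min |x| (2 ^ k) := fun x => by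
      rw [abs_mul, abs_of_nonneg (hγ0 i), mul_min_of_nonneg _ _ (hγ0 i)]
    simp_rw [e2]
    rw [integral_const_mul]
    exact mul_le_mul_of_nonneg_left (integral_min_abs_two_pow_le k) (hγ0 i)
  have hYint : ∀ i, Integrable (fun c => min |X i c| (γ i * 2 ^ k)) (cauchyPi ι) := by
    intro i
    have := integrable_min_abs (γ i * 2 ^ k) ((cauchyPi ι).map (X i))
    exact this.comp_measurable (hXm i)
  have hYE : ∫ c, Y c ∂(cauchyPi ι) ≤ g * (1 + k) := by
    rw [hY, integral_finsetSum _ fun i _ => hYint i]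
    calc _ ≤ ∑ i, γ i * (1 + k) := Finset.sum_le_sum fun i _ => hYi i
      _ = (∑ i, γ i) * (1 + k) := by rw [Finset.sum_mul]
      _ ≤ _ := by gcongr
  have hYtail : (cauchyPi ι).real {c | t * g ≤ Y c} ≤ (1 + k) / t := by
    have := mul_meas_ge_le_integral_of_nonneg (μ := cauchyPi ι) (f := Y)
      (ae_of_all _ fun c => Finset.sum_nonneg fun i _ =>
        le_min (abs_nonneg _) (mul_nonneg (hγ0 i) (by positivity)))
      (integrable_finsetSum _ fun i _ => hYint i) (t * g)
    rw [le_div_iff₀ ht]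
    have h2 := this.trans hYE
    nlinarith
  have hsub : {c | t * g ≤ ∑ i, |∑ j, c j * a i j|}
      ⊆ (⋃ i, {c | γ i * 2 ^ k < |X i c|}) ∪ {c | t * g ≤ Y c} := by
    intro c hc
    by_cases hex : ∃ i, γ i * 2 ^ k < |X i c|
    · exact Or.inl (Set.mem_iUnion.2 hex)
    · push Not at hex
      right
      have : Y c = ∑ i, |∑ j, c j * a i j| :=
        Finset.sum_congr rfl fun i _ => min_eq_left (hex i)
      change t * g ≤ Y c
      rw [this]
      exact hc
  refine (measureReal_mono hsub).trans ((measureReal_union_le _ _).trans (add_le_add ?_ hYtail))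
  refine (measureReal_iUnion_fintype_le _).trans ((Finset.sum_le_sum fun i _ => hbig i).trans ?_)
  simp [div_eq_mul_inv]

/-- Lower tail of the `ℓ₁` norm of the vector of bucket sums of independent Cauchy variables. -/
lemma cauchyPi_sum_abs_bucket_le [DecidableEq κ] (h : ι → κ) (y : ι → ℝ) (g : κ → ℝ)
    (hg0 : ∀ i, 0 ≤ g i) (hg : ∀ i, g i ≤ ∑ j with h j = i, |y j|) {b : ℝ} (hb : 0 < b)
    (hgb : ∑ i, g i ^ 2 ≤ b) :
    (cauchyPi ι).real {c | ∑ i, |∑ j with h j = i, c j * y j| ≤ (∑ i, g i) / 8}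
      ≤ Real.exp (-((∑ i, g i) ^ 2 / (128 * b))) := by
  set G := ∑ i, g i with hG
  have hG0 : 0 ≤ G := Finset.sum_nonneg fun i _ => hg0 i
  set θ := G / (8 * b) with hθ
  have hθ0 : 0 ≤ θ := by positivity
  set γ : κ → ℝ := fun i => ∑ j with h j = i, |y j| with hγ
  have hγ0 : ∀ i, 0 ≤ γ i := fun i => Finset.sum_nonneg fun j _ => abs_nonneg _
  set F : (ι → ℝ) → κ → ℝ := fun c i => ∑ j with h j = i, c j * y j with hF
  have hFm : Measurable F := by fun_prop
  have : ∀ i, IsProbabilityMeasure ((cauchyMeasure 0 1).map (γ i * ·)) := fun i =>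
    Measure.isProbabilityMeasure_map (by fun_prop)
  have hmgf : ∫ c, Real.exp (-(θ * ∑ i, |F c i|)) ∂(cauchyPi ι)
      ≤ Real.exp (-(θ * G / 4) + θ ^ 2 * b / 2) := by
    have e1 : ∫ c, Real.exp (-(θ * ∑ i, |F c i|)) ∂(cauchyPi ι)
        = ∫ z : κ → ℝ, ∏ i, Real.exp (-(θ * |z i|)) ∂((cauchyPi ι).map F) := by
      have hmeas : Measurable fun z : κ → ℝ => ∏ i, Real.exp (-(θ * |z i|)) := by fun_prop
      rw [integral_map hFm.aemeasurable hmeas.aestronglyMeasurable]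
      refine integral_congr_ae (ae_of_all _ fun c => ?_)
      simp only [← Real.exp_sum, Finset.sum_neg_distrib, Finset.mul_sum]
    rw [e1, hF, map_bucketSums_cauchyPi,
      integral_fintype_prod_eq_prod (fun i (x : ℝ) => Real.exp (-(θ * |x|)))]
    calc ∏ i, ∫ x, Real.exp (-(θ * |x|)) ∂((cauchyMeasure 0 1).map (γ i * ·))
        ≤ ∏ i, Real.exp (-(θ * g i / 4) + (θ * g i) ^ 2 / 2) := by
          refine Finset.prod_le_prod (fun i _ => integral_nonneg fun x => (Real.exp_pos _).le) ?_
          intro i _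
          rw [integral_map (by fun_prop) (by fun_prop)]
          refine le_trans (integral_mono ?_ ?_ fun x => ?_)
            (integral_exp_neg_mul_abs_le (mul_nonneg hθ0 (hg0 i)))
          · refine Integrable.of_bound (C := 1) (by fun_prop) (ae_of_all _ fun x => ?_)
            rw [Real.norm_eq_abs, Real.abs_exp, Real.exp_le_one_iff]
            have : 0 ≤ θ * |γ i * x| := by positivity
            linarith
          · refine Integrable.of_bound (C := 1) (by fun_prop) (ae_of_all _ fun x => ?_)
            rw [Real.norm_eq_abs, Real.abs_exp, Real.exp_le_one_iff]
            have : 0 ≤ θ * g i * |x| := mul_nonneg (mul_nonneg hθ0 (hg0 i)) (abs_nonneg _)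
            linarith
          · simp only [abs_mul, abs_of_nonneg (hγ0 i)]
            gcongr Real.exp (-?_)
            rw [mul_assoc]
            gcongr
            exact hg i
      _ = Real.exp (-(θ * G / 4) + θ ^ 2 * (∑ i, g i ^ 2) / 2) := by
          rw [← Real.exp_sum, Finset.sum_add_distrib, Finset.sum_neg_distrib, hG]
          congr 2
          · rw [Finset.mul_sum, Finset.sum_div]
          · rw [Finset.mul_sum, Finset.sum_div]
            exact Finset.sum_congr rfl fun i _ => by ring
      _ ≤ _ := by gcongr
  have hint : Integrable (fun c => Real.exp (-(θ * ∑ i, |F c i|))) (cauchyPi ι) := by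
    refine Integrable.of_bound (C := 1) (by fun_prop) (ae_of_all _ fun x => ?_)
    rw [Real.norm_eq_abs, Real.abs_exp, Real.exp_le_one_iff]
    have : 0 ≤ θ * ∑ i, |F x i| := mul_nonneg hθ0 (Finset.sum_nonneg fun i _ => abs_nonneg _)
    linarith
  have hmk := mul_meas_ge_le_integral_of_nonneg (μ := cauchyPi ι)
    (ae_of_all _ fun c => (Real.exp_pos (-(θ * ∑ i, |F c i|))).le) hint
    (Real.exp (-(θ * (G / 8))))
  have hsub : {c | ∑ i, |∑ j with h j = i, c j * y j| ≤ G / 8}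
      ⊆ {c | Real.exp (-(θ * (G / 8))) ≤ Real.exp (-(θ * ∑ i, |F c i|))} := by
    intro c hc
    change Real.exp _ ≤ Real.exp _
    gcongr
    exact hc
  refine (measureReal_mono hsub).trans ?_
  have hpos := Real.exp_pos (-(θ * (G / 8)))
  refine le_of_mul_le_mul_left ((hmk.trans hmgf).trans (le_of_eq ?_)) hpos
  rw [← Real.exp_add]
  congr 1
  rw [hθ]
  field_simp
  ring

end Tails

section Hashing

/-- The law of a uniformly random hash function. -/
abbrev hashLaw (s n : ℕ) : Measure (Fin n → Fin s) :=
  Measure.pi fun _ : Fin n => uniformOn (Set.univ : Set (Fin s))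

lemma uniformOn_real_singleton {s : ℕ} (i : Fin s) :
    (uniformOn (Set.univ : Set (Fin s))).real {i} = 1 / s := by
  simp [Measure.real, uniformOn_univ]

variable {s n : ℕ} [NeZero s]

/-- Two distinct indices collide with probability `1 / s`. -/
lemma hashLaw_collision_le {j k : Fin n} (hjk : j ≠ k) :
    (hashLaw s n).real {h | h j = h k} ≤ 1 / s := by
  have hs : (s : ℝ) ≠ 0 := by exact_mod_cast NeZero.ne s
  have hset : {h : Fin n → Fin s | h j = h k}
      ⊆ ⋃ i, Set.univ.pi fun l => if l = j ∨ l = k then {i} else Set.univ := by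
    intro h hh
    refine Set.mem_iUnion.2 ⟨h j, fun l _ => ?_⟩
    change h l ∈ (if l = j ∨ l = k then {h j} else Set.univ : Set (Fin s))
    by_cases hl : l = j ∨ l = k
    · rw [if_pos hl]
      rcases hl with rfl | rfl
      · rfl
      · exact (Eq.symm hh)
    · rw [if_neg hl]; trivial
  refine (measureReal_mono hset).trans ((measureReal_iUnion_fintype_le _).trans ?_)
  have hi : ∀ i : Fin s, (hashLaw s n).real
      (Set.univ.pi fun l => if l = j ∨ l = k then {i} else Set.univ) = (1 / s : ℝ) ^ 2 := by
    intro i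
    have h1 : ∀ l : Fin n, (uniformOn (Set.univ : Set (Fin s))).real
        (if l = j ∨ l = k then {i} else Set.univ) = if l = j ∨ l = k then (1 / s : ℝ) else 1 := by
      intro l
      split_ifs
      · exact uniformOn_real_singleton i
      · simp
    rw [Measure.real, Measure.pi_pi, ENNReal.toReal_prod]
    change ∏ l : Fin n, (uniformOn (Set.univ : Set (Fin s))).real _ = _
    simp_rw [h1]
    rw [Finset.prod_ite, Finset.prod_const_one, mul_one, Finset.prod_const]
    congr 1
    have : (Finset.univ.filter fun l : Fin n => l = j ∨ l = k) = {j, k} := by ext; simp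
    rw [this, Finset.card_pair hjk]
  simp_rw [hi]
  simp
  field_simp
  rfl

/-- Markov's inequality for weighted numbers of collisions. -/
lemma hashLaw_weighted_collisions_le (w : Fin n → Fin n → ℝ) (hw : ∀ j k, 0 ≤ w j k) {g : ℝ}
    (hg : 0 < g) (hwg : 20 * ∑ j, ∑ k, w j k ≤ s * g) :
    (hashLaw s n).real {h | g ≤ ∑ j, ∑ k, if j ≠ k ∧ h j = h k then w j k else 0} ≤ 1 / 20 := by
  have hs : (0 : ℝ) < s := by exact_mod_cast Nat.pos_of_ne_zero (NeZero.ne s)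
  have hE : ∫ h, (∑ j, ∑ k, if j ≠ k ∧ h j = h k then w j k else 0) ∂(hashLaw s n)
      ≤ (∑ j, ∑ k, w j k) / s := by
    rw [integral_finsetSum _ fun _ _ => Integrable.of_finite, Finset.sum_div]
    refine Finset.sum_le_sum fun j _ => ?_
    rw [integral_finsetSum _ fun _ _ => Integrable.of_finite, Finset.sum_div]
    refine Finset.sum_le_sum fun k _ => ?_
    by_cases hjk : j = k
    · simp [hjk]
      have := hw k k
      positivity
    · have : ∀ h : Fin n → Fin s, (if j ≠ k ∧ h j = h k then w j k else 0)
          = {h : Fin n → Fin s | h j = h k}.indicator (fun _ => w j k) h := by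
        intro h
        by_cases hh : h j = h k <;> simp [hh, hjk]
      simp_rw [this]
      rw [integral_indicator_const _ (Set.toFinite _).measurableSet, smul_eq_mul]
      calc _ ≤ 1 / s * w j k := by
            gcongr
            · exact hw j k
            · exact hashLaw_collision_le hjk
        _ = _ := by ring
  have hmk := mul_meas_ge_le_integral_of_nonneg (μ := hashLaw s n)
    (f := fun h => ∑ j, ∑ k, if j ≠ k ∧ h j = h k then w j k else 0)
    (ae_of_all _ fun h => Finset.sum_nonneg fun j _ => Finset.sum_nonneg fun k _ => by
      split_ifs
      · exact hw j k
      · exact le_rfl) Integrable.of_finite g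
  have h2 := hmk.trans hE
  rw [le_div_iff₀ hs] at h2
  refine le_of_mul_le_mul_left ?_ (mul_pos hs hg)
  nlinarith

end Hashing

section Auerbach

variable {n d : ℕ}

lemma mulVec_injective_of_rank_eq {A : Matrix (Fin n) (Fin d) ℝ} (hA : A.rank = d) :
    Function.Injective A.mulVec := by
  have h := A.mulVecLin.finrank_range_add_finrank_ker
  have h1 : Module.finrank ℝ (LinearMap.range A.mulVecLin) = d := hA
  rw [h1, Module.finrank_fin_fun] at h
  have h2 : Module.finrank ℝ (LinearMap.ker A.mulVecLin) = 0 := by omega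
  exact LinearMap.ker_eq_bot.1 (Submodule.finrank_eq_zero.1 h2)

lemma isCompact_sum_abs_mulVec_le_one {A : Matrix (Fin n) (Fin d) ℝ} (hA : A.rank = d) :
    IsCompact {x : Fin d → ℝ | ∑ j, |(A *ᵥ x) j| ≤ 1} := by
  have hinj := mulVec_injective_of_rank_eq hA
  obtain ⟨K, -, hK⟩ := A.mulVecLin.exists_antilipschitzWith (LinearMap.ker_eq_bot.2 hinj)
  refine Metric.isCompact_of_isClosed_isBounded ?_ ?_
  · exact isClosed_le (by fun_prop) continuous_const
  · refine (hK.isBounded_preimage (Metric.isBounded_closedBall (x := 0) (r := 1))).subset ?_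
    intro x hx
    have hx' : ∑ j, |(A *ᵥ x) j| ≤ 1 := hx
    rw [Set.mem_preimage, mem_closedBall_zero_iff, pi_norm_le_iff_of_nonneg zero_le_one]
    intro j
    exact (Finset.single_le_sum (f := fun j => |(A *ᵥ x) j|) (fun j _ => abs_nonneg _)
      (Finset.mem_univ j)).trans hx'

/-- Auerbach's lemma for the `ℓ₁` norm on the column space of `A`. -/
lemma exists_auerbach_basis {A : Matrix (Fin n) (Fin d) ℝ} (hA : A.rank = d) :
    ∃ V : Matrix (Fin d) (Fin d) ℝ, IsUnit V ∧ (∀ k, ∑ j, |(A * V) j k| ≤ 1) ∧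
      ∀ (x : Fin d → ℝ) (k : Fin d), |x k| ≤ ∑ j, |((A * V) *ᵥ x) j| := by
  set N : (Fin d → ℝ) → ℝ := fun x => ∑ j, |(A *ᵥ x) j| with hN
  have hNsmul : ∀ (a : ℝ) (x : Fin d → ℝ), N (a • x) = |a| * N x := by
    intro a x
    simp [hN, Matrix.mulVec_smul, abs_mul, Finset.mul_sum]
  have hN0 : ∀ x, 0 ≤ N x := fun x => Finset.sum_nonneg fun j _ => abs_nonneg _
  set B : Set (Fin d → Fin d → ℝ) := Set.univ.pi fun _ => {x | N x ≤ 1} with hB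
  have hBc : IsCompact B := isCompact_univ_pi fun _ => isCompact_sum_abs_mulVec_le_one hA
  have hcont : ContinuousOn (fun v : Fin d → Fin d → ℝ => |(Matrix.of v).det|) B := by
    refine Continuous.continuousOn ?_
    exact (Continuous.matrix_det (A := fun v : Fin d → Fin d → ℝ => Matrix.of v)
      continuous_id).abs
  obtain ⟨v, hvB, hvmax⟩ := hBc.exists_isMaxOn ⟨0, fun k _ => by simp [hN]⟩ hcont
  have hdet : (Matrix.of v).det ≠ 0 := by
    set M := 1 + ∑ k, N (Pi.single k 1) with hM
    have hM0 : 0 < M := by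
      have : 0 ≤ ∑ k, N (Pi.single k 1) := Finset.sum_nonneg fun k _ => hN0 _
      linarith
    have hmem : (fun k => M⁻¹ • (Pi.single k 1 : Fin d → ℝ)) ∈ B := by
      intro k _
      change N _ ≤ 1
      rw [hNsmul, abs_of_pos (inv_pos.2 hM0), inv_mul_le_iff₀ hM0, mul_one]
      have := Finset.single_le_sum (f := fun k => N (Pi.single k 1)) (fun k _ => hN0 _)
        (Finset.mem_univ k)
      linarith
    have h1 := hvmax hmem
    have h2 : Matrix.of (fun k => M⁻¹ • (Pi.single k 1 : Fin d → ℝ))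
        = M⁻¹ • (1 : Matrix (Fin d) (Fin d) ℝ) := by
      ext i j
      simp [Matrix.one_apply, Pi.single_apply, eq_comm]
    simp only [Set.mem_ofPred_eq, h2, Matrix.det_smul, Matrix.det_one] at h1
    intro h0
    rw [h0, abs_zero] at h1
    have : 0 < |M⁻¹ ^ Fintype.card (Fin d) * 1| := by positivity
    linarith
  refine ⟨(Matrix.of v)ᵀ, ?_, ?_, ?_⟩
  · rw [Matrix.isUnit_iff_isUnit_det, Matrix.det_transpose]
    exact hdet.isUnit
  · intro k
    have : N (v k) ≤ 1 := hvB k (Set.mem_univ k)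
    exact this
  · intro x k
    rw [← Matrix.mulVec_mulVec]
    set w := (Matrix.of v)ᵀ *ᵥ x with hw
    change |x k| ≤ N w
    have hcr : ((Matrix.of v)ᵀ.updateCol k w).det = x k * (Matrix.of v).det := by
      rw [← Matrix.cramer_apply, Matrix.cramer_eq_adjugate_mulVec, hw, Matrix.mulVec_mulVec,
        Matrix.adjugate_mul, Matrix.smul_mulVec, Matrix.one_mulVec, Matrix.det_transpose]
      simp [mul_comm]
    have hup : ∀ z : Fin d → ℝ, ((Matrix.of v)ᵀ.updateCol k z).det
        = (Matrix.of (Function.update v k z)).det := by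
      intro z
      rw [← Matrix.det_transpose, Matrix.updateCol_transpose, Matrix.transpose_transpose]
      rfl
    have hbound : ∀ z, N z ≤ 1 → |(Matrix.of (Function.update v k z)).det|
        ≤ |(Matrix.of v).det| := by
      intro z hz
      refine hvmax (a := Function.update v k z) ?_
      intro l _
      by_cases hl : l = k
      · subst hl
        simpa using hz
      · simpa [hl] using hvB l (Set.mem_univ l)
    have hlin : ∀ a : ℝ, (Matrix.of (Function.update v k (a • w))).det
        = a * (x k * (Matrix.of v).det) := by
      intro a
      rw [← hup, Matrix.det_updateCol_smul, hcr]
    have hmain : ∀ a : ℝ, |a| * N w ≤ 1 → |a| * |x k| ≤ 1 := by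
      intro a ha
      have := hbound (a • w) (by rwa [hNsmul])
      rw [hlin, abs_mul, abs_mul, ← mul_assoc] at this
      exact le_of_mul_le_mul_right (by simpa using this) (abs_pos.2 hdet)
    rcases (hN0 w).eq_or_lt with h0 | h0
    · by_contra hlt
      rw [← h0, not_le] at hlt
      have := hmain (2 / |x k|) (by rw [← h0]; simp)
      rw [abs_of_pos (by positivity), div_mul_cancel₀ _ hlt.ne'] at this
      norm_num at this
    · have := hmain (N w)⁻¹ (by rw [abs_of_pos (inv_pos.2 h0), inv_mul_cancel₀ h0.ne'])
      rwa [abs_of_pos (inv_pos.2 h0), inv_mul_le_iff₀ h0, mul_one] at this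

end Auerbach

section BucketSums

variable {n d s : ℕ}

lemma l1Norm_eq_sum_abs {m : ℕ} (v : Fin m → ℝ) : l1Norm v = ∑ i, |v i| := by
  simp [l1Norm, PiLp.norm_eq_of_L1]

/-- The vector `S C y`, for `S` the hashing matrix of `h` and `C = diag(c)`. -/
def bucketSum (h : Fin n → Fin s) (c y : Fin n → ℝ) (i : Fin s) : ℝ :=
  ∑ j with h j = i, c j * y j

lemma embeddingMatrix_mulVec (h : Fin n → Fin s) (c y : Fin n → ℝ) :
    embeddingMatrix h c *ᵥ y = bucketSum h c y := by
  ext i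
  rw [embeddingMatrix, ← Matrix.mulVec_mulVec]
  simp [Matrix.mulVec, dotProduct, hashMatrix, bucketSum, Finset.sum_filter, Matrix.diagonal_apply]

lemma bucketSum_eq_sum_ite (h : Fin n → Fin s) (c y : Fin n → ℝ) (i : Fin s) :
    bucketSum h c y i = ∑ j, c j * (if h j = i then y j else 0) := by
  simp [bucketSum, Finset.sum_filter]

lemma bucketSum_sub (h : Fin n → Fin s) (c y z : Fin n → ℝ) (i : Fin s) :
    bucketSum h c (y - z) i = bucketSum h c y i - bucketSum h c z i := by
  simp [bucketSum, mul_sub]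

lemma bucketSum_mulVec (h : Fin n → Fin s) (c : Fin n → ℝ) (U : Matrix (Fin n) (Fin d) ℝ)
    (x : Fin d → ℝ) (i : Fin s) :
    bucketSum h c (U *ᵥ x) i = ∑ k, x k * bucketSum h c (fun j => U j k) i := by
  simp only [bucketSum, Matrix.mulVec, dotProduct, Finset.mul_sum]
  rw [Finset.sum_comm]
  exact Finset.sum_congr rfl fun k _ => Finset.sum_congr rfl fun j _ => by ring

lemma sum_abs_bucketSum_mulVec_le (h : Fin n → Fin s) (c : Fin n → ℝ)
    (U : Matrix (Fin n) (Fin d) ℝ) {x : Fin d → ℝ} {r : ℝ} (hx : ∀ k, |x k| ≤ r) :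
    ∑ i, |bucketSum h c (U *ᵥ x) i| ≤ r * ∑ i, ∑ k, |bucketSum h c (fun j => U j k) i| := by
  rw [Finset.mul_sum]
  refine Finset.sum_le_sum fun i _ => ?_
  rw [bucketSum_mulVec, Finset.mul_sum]
  refine (Finset.abs_sum_le_sum_abs _ _).trans (Finset.sum_le_sum fun k _ => ?_)
  rw [abs_mul]
  exact mul_le_mul_of_nonneg_right (hx k) (abs_nonneg _)

lemma abs_mulVec_le (U : Matrix (Fin n) (Fin d) ℝ) {x : Fin d → ℝ} {r : ℝ}
    (hx : ∀ k, |x k| ≤ r) (j : Fin n) : |(U *ᵥ x) j| ≤ r * ∑ k, |U j k| := by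
  rw [Matrix.mulVec, dotProduct, Finset.mul_sum]
  refine (Finset.abs_sum_le_sum_abs _ _).trans (Finset.sum_le_sum fun k _ => ?_)
  rw [abs_mul, mul_comm]
  exact mul_le_mul_of_nonneg_right (hx k) (abs_nonneg _)

/-- If the indices in `H` are hashed perfectly, their contribution is lost only to the other indices
in their buckets. -/
lemma sum_abs_heavy_le (h : Fin n → Fin s) (c y : Fin n → ℝ) (H : Finset (Fin n))
    (hH : Set.InjOn h H) :
    ∑ j ∈ H, |c j * y j| ≤ ∑ i, |bucketSum h c y i| +
      ∑ i, |bucketSum h c (fun j => if j ∉ H ∧ ∃ l ∈ H, h l = h j then y j else 0) i| := by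
  set y' : Fin n → ℝ := fun j => if j ∉ H ∧ ∃ l ∈ H, h l = h j then y j else 0 with hy'
  have hsplit : ∀ j ∈ H, bucketSum h c y (h j) = c j * y j + bucketSum h c y' (h j) := by
    intro j hj
    have : bucketSum h c y (h j)
        = ∑ l with h l = h j, ((if l = j then c j * y j else 0) + c l * y' l) := by
      refine Finset.sum_congr rfl fun l hl => ?_
      have hl' : h l = h j := (Finset.mem_filter.1 hl).2
      by_cases hlH : l ∈ H
      · have hlj : l = j := hH hlH hj hl'
        simp [hlj, hy', hj]
      · have hlj : l ≠ j := fun e => hlH (e ▸ hj)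
        have hc : l ∉ H ∧ ∃ l' ∈ H, h l' = h l := ⟨hlH, j, hj, hl'.symm⟩
        simp only [hlj, if_false, hy', if_pos hc, zero_add]
    rw [this, Finset.sum_add_distrib, Finset.sum_ite_eq']
    simp [bucketSum]
  have hle : ∀ z : Fin n → ℝ, ∑ j ∈ H, |bucketSum h c z (h j)| ≤ ∑ i, |bucketSum h c z i| := by
    intro z
    rw [← Finset.sum_image (f := fun i => |bucketSum h c z i|) (g := h) hH]
    exact Finset.sum_le_sum_of_subset_of_nonneg (Finset.subset_univ _) fun _ _ _ => abs_nonneg _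
  calc ∑ j ∈ H, |c j * y j|
      ≤ ∑ j ∈ H, (|bucketSum h c y (h j)| + |bucketSum h c y' (h j)|) := by
        refine Finset.sum_le_sum fun j hj => ?_
        have : c j * y j = bucketSum h c y (h j) - bucketSum h c y' (h j) := by
          rw [hsplit j hj]; ring
        rw [this]
        exact abs_sub _ _
    _ ≤ _ := by
        rw [Finset.sum_add_distrib]
        exact add_le_add (hle y) (hle y')

end BucketSums

section GoodHash

variable {n d s : ℕ}

/-- The `ℓ₁` norm of the `j`-th row of `U`. -/
def rowNorm (U : Matrix (Fin n) (Fin d) ℝ) (j : Fin n) : ℝ := ∑ k, |U j k|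

lemma rowNorm_nonneg (U : Matrix (Fin n) (Fin d) ℝ) (j : Fin n) : 0 ≤ rowNorm U j :=
  Finset.sum_nonneg fun _ _ => abs_nonneg _

lemma sum_rowNorm_le {U : Matrix (Fin n) (Fin d) ℝ} (hU : ∀ k, ∑ j, |U j k| ≤ 1) :
    ∑ j, rowNorm U j ≤ d := by
  simp only [rowNorm]
  rw [Finset.sum_comm]
  exact (Finset.sum_le_sum fun k _ => hU k).trans (by simp)

/-- The rows of `U` with large `ℓ₁` norm. -/
def heavyRows (U : Matrix (Fin n) (Fin d) ℝ) (τ : ℝ) : Finset (Fin n) :=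
  Finset.univ.filter fun j => τ ≤ rowNorm U j

lemma card_heavyRows_le {U : Matrix (Fin n) (Fin d) ℝ} (hU : ∀ k, ∑ j, |U j k| ≤ 1) {τ : ℝ}
    (hτ : 0 < τ) : ((heavyRows U τ).card : ℝ) ≤ d / τ := by
  rw [le_div_iff₀ hτ, ← nsmul_eq_mul]
  refine (Finset.card_nsmul_le_sum _ (rowNorm U) τ fun j hj => (Finset.mem_filter.1 hj).2).trans ?_
  exact (Finset.sum_le_sum_of_subset_of_nonneg (Finset.subset_univ _)
    fun j _ _ => rowNorm_nonneg U j).trans (sum_rowNorm_le hU)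

/-- The part of `U` made of the light rows which share a bucket with a heavy row. -/
def shadow (U : Matrix (Fin n) (Fin d) ℝ) (τ : ℝ) (h : Fin n → Fin s) :
    Matrix (Fin n) (Fin d) ℝ :=
  Matrix.of fun j k =>
    if j ∉ heavyRows U τ ∧ ∃ l ∈ heavyRows U τ, h l = h j then U j k else 0

/-- Hash functions which separate the heavy rows from each other, and which produce few collisions
among light rows and between light and heavy rows. -/
structure GoodHash (U : Matrix (Fin n) (Fin d) ℝ) (τ z : ℝ) (h : Fin n → Fin s) : Prop where
  injOn : Set.InjOn h (heavyRows U τ)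
  light : (∑ j, ∑ k, if j ≠ k ∧ h j = h k then
    (if j ∉ heavyRows U τ ∧ k ∉ heavyRows U τ then rowNorm U j * rowNorm U k else 0) else 0) ≤ τ
  shadow : ∑ j, rowNorm (shadow U τ h) j ≤ z

lemma hashLaw_not_goodHash_le [NeZero s] {U : Matrix (Fin n) (Fin d) ℝ}
    (hU : ∀ k, ∑ j, |U j k| ≤ 1) {τ z : ℝ} (hτ : 0 < τ) (hz : 0 < z)
    (h1 : 20 * (d / τ) ^ 2 ≤ s) (h2 : 20 * (d : ℝ) ^ 2 ≤ s * τ) (h3 : 20 * (d * (d / τ)) ≤ s * z) :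
    (hashLaw s n).real {h | ¬ GoodHash U τ z h} ≤ 3 / 20 := by
  set H := heavyRows U τ with hH
  have hcard := card_heavyRows_le hU hτ
  have hsum := sum_rowNorm_le hU
  have hd0 : 0 ≤ (d : ℝ) / τ := by positivity
  have hr0 := rowNorm_nonneg U
  set w₁ : Fin n → Fin n → ℝ := fun j k => if j ∈ H ∧ k ∈ H then 1 else 0 with hw₁
  set w₂ : Fin n → Fin n → ℝ := fun j k =>
    if j ∉ H ∧ k ∉ H then rowNorm U j * rowNorm U k else 0 with hw₂
  set w₃ : Fin n → Fin n → ℝ := fun j k => if j ∉ H ∧ k ∈ H then rowNorm U j else 0 with hw₃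
  have n₁ : ∀ j k, 0 ≤ w₁ j k := fun j k => by simp only [hw₁]; split_ifs <;> norm_num
  have n₂ : ∀ j k, 0 ≤ w₂ j k := fun j k => by
    simp only [hw₂]; split_ifs
    · exact mul_nonneg (hr0 j) (hr0 k)
    · exact le_rfl
  have n₃ : ∀ j k, 0 ≤ w₃ j k := fun j k => by
    simp only [hw₃]; split_ifs
    · exact hr0 j
    · exact le_rfl
  have s₁ : ∑ j, ∑ k, w₁ j k ≤ (d / τ) ^ 2 := by
    have : ∑ j, ∑ k, w₁ j k = (H.card : ℝ) ^ 2 := by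
      have : ∀ j k, w₁ j k = (if j ∈ H then 1 else 0) * (if k ∈ H then 1 else 0) := fun j k => by
        by_cases hj : j ∈ H <;> by_cases hk : k ∈ H <;> simp [hw₁, hj, hk]
      simp_rw [this, ← Finset.mul_sum, ← Finset.sum_mul]
      simp [sq]
    rw [this]
    gcongr
  have s₂ : ∑ j, ∑ k, w₂ j k ≤ (d : ℝ) ^ 2 := by
    calc ∑ j, ∑ k, w₂ j k ≤ ∑ j, ∑ k, rowNorm U j * rowNorm U k := by
          refine Finset.sum_le_sum fun j _ => Finset.sum_le_sum fun k _ => ?_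
          simp only [hw₂]; split_ifs
          · exact le_rfl
          · exact mul_nonneg (hr0 j) (hr0 k)
      _ = (∑ j, rowNorm U j) ^ 2 := by rw [sq, Finset.sum_mul_sum]
      _ ≤ _ := by
          have : 0 ≤ ∑ j, rowNorm U j := Finset.sum_nonneg fun j _ => hr0 j
          gcongr
  have s₃ : ∑ j, ∑ k, w₃ j k ≤ d * (d / τ) := by
    calc ∑ j, ∑ k, w₃ j k ≤ ∑ j, ∑ k, rowNorm U j * (if k ∈ H then 1 else 0) := by
          refine Finset.sum_le_sum fun j _ => Finset.sum_le_sum fun k _ => ?_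
          by_cases hj : j ∈ H <;> by_cases hk : k ∈ H <;> simp [hw₃, hj, hk, hr0 j]
      _ = (∑ j, rowNorm U j) * H.card := by
          simp_rw [← Finset.mul_sum, ← Finset.sum_mul]
          simp
      _ ≤ _ := by gcongr
  have p₁ := hashLaw_weighted_collisions_le (s := s) w₁ n₁ (g := 1) one_pos (by linarith)
  have p₂ := hashLaw_weighted_collisions_le (s := s) w₂ n₂ hτ (by linarith)
  have p₃ := hashLaw_weighted_collisions_le (s := s) w₃ n₃ hz (by linarith)
  have hsub : {h : Fin n → Fin s | ¬ GoodHash U τ z h} ⊆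
      ({h | 1 ≤ ∑ j, ∑ k, if j ≠ k ∧ h j = h k then w₁ j k else 0} ∪
      {h | τ ≤ ∑ j, ∑ k, if j ≠ k ∧ h j = h k then w₂ j k else 0}) ∪
      {h | z ≤ ∑ j, ∑ k, if j ≠ k ∧ h j = h k then w₃ j k else 0} := by
    intro h hbad
    by_contra hcon
    simp only [Set.mem_union, Set.mem_ofPred_eq, not_or, not_le] at hcon
    obtain ⟨⟨c₁, c₂⟩, c₃⟩ := hcon
    refine hbad ⟨?_, c₂.le, ?_⟩
    · intro j hj k hk hjk
      by_contra hne
      have hnn : ∀ j k : Fin n, 0 ≤ if j ≠ k ∧ h j = h k then w₁ j k else 0 := fun j k => by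
        split_ifs
        · exact n₁ j k
        · exact le_rfl
      have e1 := Finset.single_le_sum (f := fun k => if j ≠ k ∧ h j = h k then w₁ j k else 0)
        (fun k _ => hnn j k) (Finset.mem_univ k)
      have e2 := Finset.single_le_sum
        (f := fun j => ∑ k, if j ≠ k ∧ h j = h k then w₁ j k else 0)
        (fun j _ => Finset.sum_nonneg fun k _ => hnn j k) (Finset.mem_univ j)
      have e3 : (if j ≠ k ∧ h j = h k then w₁ j k else 0) = 1 := by
        rw [if_pos ⟨hne, hjk⟩]
        exact if_pos ⟨hj, hk⟩
      rw [e3] at e1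
      linarith
    · refine le_trans (Finset.sum_le_sum fun j _ => ?_) c₃.le
      have hnn : ∀ k : Fin n, 0 ≤ if j ≠ k ∧ h j = h k then w₃ j k else 0 := fun k => by
        split_ifs
        · exact n₃ j k
        · exact le_rfl
      by_cases hj : j ∉ heavyRows U τ ∧ ∃ l ∈ heavyRows U τ, h l = h j
      · obtain ⟨hjH, l, hl, hlj⟩ := hj
        have e0 : rowNorm (SparseCauchy.shadow U τ h) j = rowNorm U j := by
          simp only [rowNorm, SparseCauchy.shadow, Matrix.of_apply]
          simp only [if_pos (show j ∉ heavyRows U τ ∧ ∃ l ∈ heavyRows U τ, h l = h j from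
            ⟨hjH, l, hl, hlj⟩)]
        have e1 := Finset.single_le_sum (f := fun k => if j ≠ k ∧ h j = h k then w₃ j k else 0)
          (fun k _ => hnn k) (Finset.mem_univ l)
        refine le_trans (le_of_eq ?_) e1
        have hne : j ≠ l := fun e => hjH (e ▸ hl)
        rw [e0, if_pos ⟨hne, hlj.symm⟩]
        exact (if_pos ⟨hjH, hl⟩).symm
      · have e0 : rowNorm (SparseCauchy.shadow U τ h) j = 0 := by
          simp only [rowNorm, SparseCauchy.shadow, Matrix.of_apply, if_neg hj]
          simp
        rw [e0]
        exact Finset.sum_nonneg fun k _ => hnn k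
  refine (measureReal_mono hsub).trans ((measureReal_union_le _ _).trans ?_)
  have := measureReal_union_le (μ := hashLaw s n)
    {h | 1 ≤ ∑ j, ∑ k, if j ≠ k ∧ h j = h k then w₁ j k else 0}
    {h | τ ≤ ∑ j, ∑ k, if j ≠ k ∧ h j = h k then w₂ j k else 0}
  linarith

end GoodHash

section GoodWeights

variable {n d s : ℕ}

/-- The grid point `z / M`. -/
def gridPoint (M : ℕ) (z : Fin d → ℤ) : Fin d → ℝ := fun k => (z k : ℝ) / M

/-- Cauchy weights for which the embedding is bounded above, is bounded below on the heavy rows, is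
small on the light rows hashed together with heavy ones, and is bounded below on all grid points
with a large light part. -/
structure GoodWeights (U : Matrix (Fin n) (Fin d) ℝ) (τ u B : ℝ) (M : ℕ) (h : Fin n → Fin s)
    (c : Fin n → ℝ) : Prop where
  upper : ∑ i, ∑ k, |bucketSum h c (fun j => U j k) i| ≤ B
  heavy : ∀ j ∈ heavyRows U τ, u ≤ |c j|
  shadow : ∑ i, ∑ k, |bucketSum h c (fun j => shadow U τ h j k) i| ≤ u / 4
  net : ∀ z : Fin d → ℤ, (∀ k, |z k| ≤ M) →
    1 / 4 ≤ ∑ j with j ∉ heavyRows U τ, |(U *ᵥ gridPoint M z) j| →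
    ∑ j, |(U *ᵥ gridPoint M z) j| ≤ 2 →
    1 / 32 ≤ ∑ i, |bucketSum h c (U *ᵥ gridPoint M z) i|

@[fun_prop]
lemma measurable_bucketSum (h : Fin n → Fin s) (y : Fin n → ℝ) (i : Fin s) :
    Measurable fun c : Fin n → ℝ => bucketSum h c y i := by
  unfold bucketSum
  fun_prop

lemma measurableSet_goodWeights (U : Matrix (Fin n) (Fin d) ℝ) (τ u B : ℝ) (M : ℕ)
    (h : Fin n → Fin s) : MeasurableSet {c | GoodWeights U τ u B M h c} := by
  have hset : {c | GoodWeights U τ u B M h c} =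
      ({c | ∑ i, ∑ k, |bucketSum h c (fun j => U j k) i| ≤ B} ∩
        ⋂ j ∈ heavyRows U τ, {c | u ≤ |c j|}) ∩
      ({c | ∑ i, ∑ k, |bucketSum h c (fun j => shadow U τ h j k) i| ≤ u / 4} ∩
        ⋂ (z : Fin d → ℤ) (_ : ∀ k, |z k| ≤ M)
          (_ : 1 / 4 ≤ ∑ j with j ∉ heavyRows U τ, |(U *ᵥ gridPoint M z) j|)
          (_ : ∑ j, |(U *ᵥ gridPoint M z) j| ≤ 2),
          {c | 1 / 32 ≤ ∑ i, |bucketSum h c (U *ᵥ gridPoint M z) i|}) := by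
    ext c
    simp only [Set.mem_inter_iff, Set.mem_iInter, Set.mem_ofPred_eq]
    exact ⟨fun g => ⟨⟨g.upper, g.heavy⟩, g.shadow, g.net⟩,
      fun g => ⟨g.1.1, g.1.2, g.2.1, g.2.2⟩⟩
  rw [hset]
  refine MeasurableSet.inter (MeasurableSet.inter ?_ ?_) (MeasurableSet.inter ?_ ?_)
  · exact measurableSet_le (by fun_prop) measurable_const
  · exact Finset.measurableSet_biInter _ fun j _ => measurableSet_le measurable_const (by fun_prop)
  · exact measurableSet_le (by fun_prop) measurable_const
  · exact MeasurableSet.iInter fun z => MeasurableSet.iInter fun _ => MeasurableSet.iInter fun _ =>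
      MeasurableSet.iInter fun _ => measurableSet_le measurable_const (by fun_prop)

lemma cauchyPi_bucketSum_ge_le (h : Fin n → Fin s) (U : Matrix (Fin n) (Fin d) ℝ) {g : ℝ}
    (hg : 0 < g) (hUg : ∑ j, rowNorm U j ≤ g) {t : ℕ} (ht : 20 * (s * d) ≤ 2 ^ t) :
    (cauchyPi (Fin n)).real {c | 20 * (1 + t) * g ≤ ∑ i, ∑ k, |bucketSum h c (fun j => U j k) i|}
      ≤ 1 / 10 := by
  have hsum : ∑ p : Fin s × Fin d, ∑ j, |if h j = p.1 then U j p.2 else 0| ≤ g := by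
    refine le_trans (le_of_eq ?_) hUg
    rw [Fintype.sum_prod_type]
    simp only [rowNorm, apply_ite abs, abs_zero]
    calc ∑ i, ∑ k, ∑ j, (if h j = i then |U j k| else 0)
        = ∑ k, ∑ i, ∑ j, (if h j = i then |U j k| else 0) := Finset.sum_comm
      _ = ∑ k, ∑ j, ∑ i, (if h j = i then |U j k| else 0) :=
          Finset.sum_congr rfl fun k _ => Finset.sum_comm
      _ = ∑ k, ∑ j, |U j k| := by simp
      _ = _ := Finset.sum_comm
  have hmain := cauchyPi_sum_abs_ge_le
    (fun (p : Fin s × Fin d) j => if h j = p.1 then U j p.2 else 0) hg hsum (t := 20 * (1 + t)) (by positivity) t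
  have hset : {c : Fin n → ℝ |
      20 * (1 + t) * g ≤ ∑ i, ∑ k, |bucketSum h c (fun j => U j k) i|}
      = {c | 20 * (1 + t) * g ≤
          ∑ p : Fin s × Fin d, |∑ j, c j * (if h j = p.1 then U j p.2 else 0)|} := by
    ext c
    simp only [Set.mem_ofPred_eq, Fintype.sum_prod_type, bucketSum_eq_sum_ite]
  rw [hset]
  refine hmain.trans ?_
  have e1 : (1 + t : ℝ) / (20 * (1 + t)) = 1 / 20 := by
    have : (0 : ℝ) < 1 + t := by positivity
    field_simp
  have e2 : (Fintype.card (Fin s × Fin d) : ℝ) / 2 ^ t ≤ 1 / 20 := by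
    rw [div_le_iff₀ (by positivity)]
    have : (20 * (s * d) : ℝ) ≤ 2 ^ t := by exact_mod_cast ht
    simp
    linarith
  rw [e1]
  linarith

lemma cauchyPi_exists_abs_lt_le (H : Finset (Fin n)) {u : ℝ} (hu : 0 ≤ u) :
    (cauchyPi (Fin n)).real {c | ∃ j ∈ H, |c j| < u} ≤ H.card * u := by
  have hset : {c : Fin n → ℝ | ∃ j ∈ H, |c j| < u} = ⋃ j ∈ H, {c | |c j| < u} := by
    ext c; simp
  rw [hset]
  refine (measureReal_biUnion_finset_le _ _).trans ?_
  rw [← nsmul_eq_mul]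
  refine Finset.sum_le_card_nsmul _ _ _ fun j _ => ?_
  have hm : MeasurableSet {x : ℝ | |x| < u} := measurableSet_lt (by fun_prop) measurable_const
  have := (measurePreserving_eval (fun _ : Fin n => cauchyMeasure 0 1) j).measureReal_preimage
    hm.nullMeasurableSet
  calc _ = (cauchyMeasure 0 1).real {x : ℝ | |x| < u} := this
    _ ≤ u := cauchyMeasure_abs_lt_le hu

/-- The sum of the squares of the light masses of the buckets. -/
lemma sum_sq_lightMass_le {U : Matrix (Fin n) (Fin d) ℝ} {τ z : ℝ} (hτ : 0 < τ)
    {h : Fin n → Fin s} (hh : GoodHash U τ z h) {x : Fin d → ℝ} (hx : ∀ k, |x k| ≤ 1)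
    (hx2 : ∑ j, |(U *ᵥ x) j| ≤ 2) :
    ∑ i, (∑ j with h j = i, if j ∉ heavyRows U τ then |(U *ᵥ x) j| else 0) ^ 2 ≤ 3 * τ := by
  set v : Fin n → ℝ := fun j => if j ∉ heavyRows U τ then |(U *ᵥ x) j| else 0 with hv
  have hv0 : ∀ j, 0 ≤ v j := fun j => by simp only [hv]; split_ifs <;> simp
  have hvr : ∀ j, v j ≤ if j ∉ heavyRows U τ then rowNorm U j else 0 := by
    intro j
    simp only [hv]
    split_ifs
    · exact le_rfl
    · simpa [rowNorm] using abs_mulVec_le U hx j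
  have hvτ : ∀ j, v j ≤ τ := by
    intro j
    refine (hvr j).trans ?_
    split_ifs with hj
    · exact hτ.le
    · simp only [heavyRows, Finset.mem_filter, Finset.mem_univ, true_and, not_le] at hj
      exact hj.le
  have hvy : ∑ j, v j ≤ 2 := by
    refine le_trans (Finset.sum_le_sum fun j _ => ?_) hx2
    simp only [hv]
    split_ifs <;> simp
  have hexp : ∑ i, (∑ j with h j = i, v j) ^ 2 = ∑ j, ∑ k, if h j = h k then v j * v k else 0 := by
    simp_rw [sq, Finset.sum_filter, Finset.sum_mul_sum]
    rw [Finset.sum_comm]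
    refine Finset.sum_congr rfl fun j _ => ?_
    rw [Finset.sum_comm]
    refine Finset.sum_congr rfl fun k _ => ?_
    by_cases hjk : h j = h k
    · simp [hjk]
    · rw [if_neg hjk]
      refine Finset.sum_eq_zero fun i _ => ?_
      by_cases h1 : h j = i
      · have h2 : h k ≠ i := fun e => hjk (h1.trans e.symm)
        simp [h2]
      · simp [h1]
  rw [hexp]
  calc ∑ j, ∑ k, (if h j = h k then v j * v k else 0)
      ≤ ∑ j, ∑ k, ((if j = k then τ * v k else 0) + if j ≠ k ∧ h j = h k then
        (if j ∉ heavyRows U τ ∧ k ∉ heavyRows U τ then rowNorm U j * rowNorm U k else 0)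
          else 0) := by
        refine Finset.sum_le_sum fun j _ => Finset.sum_le_sum fun k _ => ?_
        by_cases hjk : j = k
        · subst hjk
          simpa using mul_le_mul_of_nonneg_right (hvτ j) (hv0 j)
        · by_cases hhjk : h j = h k
          · simp only [hhjk, if_true, hjk, if_false, ne_eq, not_false_eq_true, and_self, zero_add]
            have e := mul_le_mul (hvr j) (hvr k) (hv0 k) ((hv0 j).trans (hvr j))
            refine e.trans (le_of_eq ?_)
            by_cases h1 : j ∈ heavyRows U τ <;> by_cases h2 : k ∈ heavyRows U τ <;> simp [h1, h2]
          · simp [hjk, hhjk]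
    _ = τ * ∑ j, v j + ∑ j, ∑ k, (if j ≠ k ∧ h j = h k then
        (if j ∉ heavyRows U τ ∧ k ∉ heavyRows U τ then rowNorm U j * rowNorm U k else 0)
          else 0) := by
        simp_rw [Finset.sum_add_distrib]
        congr 1
        simp [Finset.mul_sum]
    _ ≤ τ * 2 + τ := by
        gcongr
        exact hh.light
    _ = 3 * τ := by ring

/-- A vector with a large light part is contracted with very small probability only. -/
lemma cauchyPi_light_le {U : Matrix (Fin n) (Fin d) ℝ} {τ z : ℝ} (hτ : 0 < τ)
    {h : Fin n → Fin s} (hh : GoodHash U τ z h) {x : Fin d → ℝ} (hx : ∀ k, |x k| ≤ 1)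
    (hx1 : 1 / 4 ≤ ∑ j with j ∉ heavyRows U τ, |(U *ᵥ x) j|)
    (hx2 : ∑ j, |(U *ᵥ x) j| ≤ 2) :
    (cauchyPi (Fin n)).real {c | ∑ i, |bucketSum h c (U *ᵥ x) i| < 1 / 32}
      ≤ Real.exp (-(1 / (6144 * τ))) := by
  set g : Fin s → ℝ := fun i =>
    ∑ j with h j = i, if j ∉ heavyRows U τ then |(U *ᵥ x) j| else 0 with hg
  have hgsum : ∑ i, g i = ∑ j with j ∉ heavyRows U τ, |(U *ᵥ x) j| := by
    rw [hg, Finset.sum_fiberwise, Finset.sum_filter]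
  have hmain := cauchyPi_sum_abs_bucket_le h (U *ᵥ x) g
    (fun i => Finset.sum_nonneg fun j _ => by split_ifs <;> simp)
    (fun i => Finset.sum_le_sum fun j _ => by split_ifs <;> simp) (b := 3 * τ) (by positivity)
    (sum_sq_lightMass_le hτ hh hx hx2)
  rw [← hgsum] at hx1
  refine le_trans (measureReal_mono fun c hc => ?_) (hmain.trans ?_)
  · have hc' : ∑ i, |bucketSum h c (U *ᵥ x) i| < 1 / 32 := hc
    change ∑ i, |bucketSum h c (U *ᵥ x) i| ≤ (∑ i, g i) / 8
    linarith
  · gcongr Real.exp (-?_)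
    have : (1 / 4 : ℝ) ^ 2 ≤ (∑ i, g i) ^ 2 := by gcongr
    calc 1 / (6144 * τ) = (1 / 4) ^ 2 / (128 * (3 * τ)) := by field_simp; norm_num
      _ ≤ _ := by gcongr

lemma cauchyPi_not_goodWeights_le {U : Matrix (Fin n) (Fin d) ℝ}
    (hU : ∀ k, ∑ j, |U j k| ≤ 1) (hd : 0 < d) {τ u z : ℝ} {M t : ℕ} (hτ : 0 < τ) (hu : 0 ≤ u)
    (hz : 0 < z) (hM : 0 < M) {h : Fin n → Fin s} (hh : GoodHash U τ z h)
    (ht : 20 * (s * d) ≤ 2 ^ t) (hud : 20 * (d / τ * u) ≤ 1) (hzu : 20 * (1 + t) * z ≤ u / 4)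
    (hnet : 20 * ((2 * M + 1 : ℝ) ^ d * Real.exp (-(1 / (6144 * τ)))) ≤ 1) :
    (cauchyPi (Fin n)).real {c | ¬ GoodWeights U τ u (20 * (1 + t) * d) M h c} ≤ 3 / 10 := by
  classical
  set N : Finset (Fin d → ℤ) := (Fintype.piFinset fun _ : Fin d => Finset.Icc (-(M : ℤ)) M).filter
    fun z => 1 / 4 ≤ ∑ j with j ∉ heavyRows U τ, |(U *ᵥ gridPoint M z) j| ∧
      ∑ j, |(U *ᵥ gridPoint M z) j| ≤ 2 with hN
  have hgrid : ∀ z ∈ N, ∀ k, |gridPoint M z k| ≤ 1 := by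
    intro z hz k
    have hzk := Finset.mem_Icc.1 (Fintype.mem_piFinset.1 (Finset.mem_filter.1 hz).1 k)
    have hM' : (0 : ℝ) < M := by exact_mod_cast hM
    rw [gridPoint, abs_div, abs_of_pos hM', div_le_one hM']
    exact_mod_cast abs_le.2 hzk
  have hNcard : (N.card : ℝ) ≤ (2 * M + 1 : ℝ) ^ d := by
    have h1 := Finset.card_filter_le (Fintype.piFinset fun _ : Fin d => Finset.Icc (-(M : ℤ)) M)
      fun z => 1 / 4 ≤ ∑ j with j ∉ heavyRows U τ, |(U *ᵥ gridPoint M z) j| ∧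
      ∑ j, |(U *ᵥ gridPoint M z) j| ≤ 2
    have h2 : (Fintype.piFinset fun _ : Fin d => Finset.Icc (-(M : ℤ)) M).card
        = (2 * M + 1) ^ d := by
      rw [Fintype.card_piFinset]
      simp only [Int.card_Icc, Finset.prod_const, Finset.card_univ, Fintype.card_fin]
      congr 1
      omega
    rw [h2] at h1
    exact_mod_cast h1
  have p₁ := cauchyPi_bucketSum_ge_le h U (g := d) (by exact_mod_cast hd) (sum_rowNorm_le hU) ht
  have p₂ := cauchyPi_exists_abs_lt_le (heavyRows U τ) hu
  have p₃ := cauchyPi_bucketSum_ge_le h (shadow U τ h) hz hh.shadow ht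
  have p₄ : (cauchyPi (Fin n)).real
      (⋃ z ∈ N, {c | ∑ i, |bucketSum h c (U *ᵥ gridPoint M z) i| < 1 / 32}) ≤ 1 / 20 := by
    refine (measureReal_biUnion_finset_le _ _).trans ?_
    calc _ ≤ ∑ z ∈ N, Real.exp (-(1 / (6144 * τ))) := by
          refine Finset.sum_le_sum fun z hzN => ?_
          have h2 := (Finset.mem_filter.1 hzN).2
          exact cauchyPi_light_le hτ hh (hgrid z hzN) h2.1 h2.2
      _ = N.card * Real.exp (-(1 / (6144 * τ))) := by simp
      _ ≤ (2 * M + 1 : ℝ) ^ d * Real.exp (-(1 / (6144 * τ))) := by gcongr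
      _ ≤ 1 / 20 := by linarith
  have p₂' : (heavyRows U τ).card * u ≤ 1 / 20 := by
    have := mul_le_mul_of_nonneg_right (card_heavyRows_le hU hτ) hu
    linarith
  set S₁ := {c : Fin n → ℝ |
    20 * (1 + t) * d ≤ ∑ i, ∑ k, |bucketSum h c (fun j => U j k) i|}
  set S₂ := {c : Fin n → ℝ | ∃ j ∈ heavyRows U τ, |c j| < u}
  set S₃ := {c : Fin n → ℝ |
    20 * (1 + t) * z ≤ ∑ i, ∑ k, |bucketSum h c (fun j => shadow U τ h j k) i|}
  set S₄ := ⋃ z ∈ N, {c : Fin n → ℝ | ∑ i, |bucketSum h c (U *ᵥ gridPoint M z) i| < 1 / 32}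
  have hsub : {c | ¬ GoodWeights U τ u (20 * (1 + t) * d) M h c} ⊆ (S₁ ∪ S₂) ∪ (S₃ ∪ S₄) := by
    intro c hbad
    by_contra hcon
    simp only [Set.mem_union, not_or] at hcon
    obtain ⟨⟨c₁, c₂⟩, c₃, c₄⟩ := hcon
    refine hbad ⟨(not_le.1 c₁).le, fun j hj => ?_, (not_le.1 c₃).le.trans hzu, ?_⟩
    · by_contra hlt
      exact c₂ ⟨j, hj, not_le.1 hlt⟩
    · intro z hzM h1 h2
      by_contra hlt
      refine c₄ (Set.mem_iUnion₂.2 ⟨z, ?_, not_le.1 hlt⟩)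
      exact Finset.mem_filter.2 ⟨Fintype.mem_piFinset.2 fun k =>
        Finset.mem_Icc.2 (abs_le.1 (hzM k)), h1, h2⟩
  have u₁ := measureReal_union_le (μ := cauchyPi (Fin n)) S₁ S₂
  have u₂ := measureReal_union_le (μ := cauchyPi (Fin n)) S₃ S₄
  have u₃ := measureReal_union_le (μ := cauchyPi (Fin n)) (S₁ ∪ S₂) (S₃ ∪ S₄)
  have u₄ := measureReal_mono (μ := cauchyPi (Fin n)) hsub
  linarith

end GoodWeights

section Distortion

variable {n d s : ℕ}

lemma GoodWeights.upper_bound {U : Matrix (Fin n) (Fin d) ℝ}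
    (hinf : ∀ (x : Fin d → ℝ) k, |x k| ≤ ∑ j, |(U *ᵥ x) j|) {τ u B : ℝ} {M : ℕ}
    {h : Fin n → Fin s} {c : Fin n → ℝ} (hc : GoodWeights U τ u B M h c) (x : Fin d → ℝ) :
    ∑ i, |bucketSum h c (U *ᵥ x) i| ≤ B * ∑ j, |(U *ᵥ x) j| := by
  refine (sum_abs_bucketSum_mulVec_le h c U (hinf x)).trans ?_
  rw [mul_comm]
  exact mul_le_mul_of_nonneg_right hc.upper (Finset.sum_nonneg fun _ _ => abs_nonneg _)

lemma abs_floor_div_sub_le {M : ℕ} (hM : 0 < M) (a : ℝ) :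
    |a - (⌊M * a⌋ : ℝ) / M| ≤ 1 / M := by
  have hM' : (0 : ℝ) < M := by exact_mod_cast hM
  have h1 := Int.floor_le (M * a)
  have h2 := Int.lt_floor_add_one (M * a)
  have e : a - (⌊M * a⌋ : ℝ) / M = (M * a - ⌊M * a⌋) / M := by field_simp
  rw [e, abs_div, abs_of_pos hM', abs_of_nonneg (by linarith)]
  gcongr
  linarith

lemma abs_floor_le {M : ℕ} {a : ℝ} (ha : |a| ≤ 1) : |⌊(M : ℝ) * a⌋| ≤ (M : ℤ) := by
  have hM' : (0 : ℝ) ≤ M := by positivity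
  obtain ⟨h1, h2⟩ := abs_le.1 ha
  rw [abs_le]
  constructor
  · rw [Int.le_floor]
    push_cast
    nlinarith
  · have : (⌊(M : ℝ) * a⌋ : ℝ) ≤ (M : ℤ) := (Int.floor_le _).trans (by push_cast; nlinarith)
    exact_mod_cast this

lemma sum_abs_mulVec_le {U : Matrix (Fin n) (Fin d) ℝ} (hU : ∀ k, ∑ j, |U j k| ≤ 1)
    {x : Fin d → ℝ} {r : ℝ} (hr : 0 ≤ r) (hx : ∀ k, |x k| ≤ r) :
    ∑ j, |(U *ᵥ x) j| ≤ r * d := by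
  refine (Finset.sum_le_sum fun j _ => abs_mulVec_le U hx j).trans ?_
  rw [← Finset.mul_sum]
  exact mul_le_mul_of_nonneg_left (sum_rowNorm_le hU) hr

lemma shadow_mulVec (U : Matrix (Fin n) (Fin d) ℝ) (τ : ℝ) (h : Fin n → Fin s) (x : Fin d → ℝ) :
    shadow U τ h *ᵥ x = fun j =>
      if j ∉ heavyRows U τ ∧ ∃ l ∈ heavyRows U τ, h l = h j then (U *ᵥ x) j else 0 := by
  ext j
  simp only [Matrix.mulVec, dotProduct, shadow, Matrix.of_apply]
  by_cases hj : j ∉ heavyRows U τ ∧ ∃ l ∈ heavyRows U τ, h l = h j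
  · simp only [if_pos hj]
  · simp only [if_neg hj]
    simp

lemma GoodWeights.lower_bound_of_norm_eq_one {U : Matrix (Fin n) (Fin d) ℝ}
    (hU : ∀ k, ∑ j, |U j k| ≤ 1)
    (hinf : ∀ (x : Fin d → ℝ) k, |x k| ≤ ∑ j, |(U *ᵥ x) j|) {τ z u B : ℝ} {M : ℕ}
    (hu0 : 0 ≤ u) (hu : u ≤ 1 / 16) (hM : 0 < M) (hMd : 4 * (d : ℝ) ≤ M) (hMB : 64 * B ≤ M)
    {h : Fin n → Fin s} (hh : GoodHash U τ z h)
    {c : Fin n → ℝ} (hc : GoodWeights U τ u B M h c) {x : Fin d → ℝ}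
    (hx : ∑ j, |(U *ᵥ x) j| = 1) :
    u / 4 ≤ ∑ i, |bucketSum h c (U *ᵥ x) i| := by
  have hM' : (0 : ℝ) < M := by exact_mod_cast hM
  have hx1 : ∀ k, |x k| ≤ 1 := fun k => hx ▸ hinf x k
  set y := U *ᵥ x with hy
  have hpart : ∑ j ∈ heavyRows U τ, |y j| + ∑ j with j ∉ heavyRows U τ, |y j| = 1 := by
    rw [← hx, ← Finset.sum_filter_add_sum_filter_not Finset.univ (· ∈ heavyRows U τ)]
    congr 2
    simp
  by_cases hlight : 1 / 2 ≤ ∑ j with j ∉ heavyRows U τ, |y j|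
  · set zz : Fin d → ℤ := fun k => ⌊(M : ℝ) * x k⌋ with hzz
    set x' := gridPoint M zz with hx'
    have hdiff : ∀ k, |(x - x') k| ≤ 1 / M := fun k => abs_floor_div_sub_le hM (x k)
    have hsub : U *ᵥ (x - x') = y - U *ᵥ x' := by rw [Matrix.mulVec_sub]
    have hdn : ∑ j, |y j - (U *ᵥ x') j| ≤ 1 / 4 := by
      have := sum_abs_mulVec_le hU (by positivity) hdiff
      rw [hsub] at this
      refine this.trans ?_
      rw [one_div, inv_mul_le_iff₀ hM']
      linarith
    have hl' : 1 / 4 ≤ ∑ j with j ∉ heavyRows U τ, |(U *ᵥ x') j| := by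
      have h1 : ∑ j with j ∉ heavyRows U τ, |y j| ≤
          ∑ j with j ∉ heavyRows U τ, |(U *ᵥ x') j| +
          ∑ j with j ∉ heavyRows U τ, |y j - (U *ᵥ x') j| := by
        rw [← Finset.sum_add_distrib]
        refine Finset.sum_le_sum fun j _ => ?_
        have := abs_add_le ((U *ᵥ x') j) (y j - (U *ᵥ x') j)
        rwa [add_sub_cancel] at this
      have h2 : ∑ j with j ∉ heavyRows U τ, |y j - (U *ᵥ x') j| ≤ ∑ j, |y j - (U *ᵥ x') j| :=
        Finset.sum_le_sum_of_subset_of_nonneg (Finset.filter_subset _ _) fun _ _ _ => abs_nonneg _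
      linarith
    have hn' : ∑ j, |(U *ᵥ x') j| ≤ 2 := by
      have h1 : ∑ j, |(U *ᵥ x') j| ≤ ∑ j, |y j| + ∑ j, |y j - (U *ᵥ x') j| := by
        rw [← Finset.sum_add_distrib]
        refine Finset.sum_le_sum fun j _ => ?_
        have := abs_sub (y j) (y j - (U *ᵥ x') j)
        rwa [sub_sub_cancel] at this
      linarith
    have hnet := hc.net zz (fun k => abs_floor_le (hx1 k)) hl' hn'
    have hBd : ∑ i, |bucketSum h c (y - U *ᵥ x') i| ≤ 1 / 64 := by
      rw [← hsub]
      refine (sum_abs_bucketSum_mulVec_le h c U hdiff).trans ?_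
      rw [one_div, inv_mul_le_iff₀ hM']
      linarith [hc.upper]
    have htri : ∑ i, |bucketSum h c (U *ᵥ x') i| ≤
        ∑ i, |bucketSum h c y i| + ∑ i, |bucketSum h c (y - U *ᵥ x') i| := by
      rw [← Finset.sum_add_distrib]
      refine Finset.sum_le_sum fun i _ => ?_
      rw [bucketSum_sub]
      have := abs_sub (bucketSum h c y i) (bucketSum h c y i - bucketSum h c (U *ᵥ x') i)
      rwa [sub_sub_cancel] at this
    linarith
  · have hheavy : 1 / 2 ≤ ∑ j ∈ heavyRows U τ, |y j| := by linarith
    have h1 := sum_abs_heavy_le h c y (heavyRows U τ) hh.injOn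
    rw [hy, ← shadow_mulVec] at h1
    have h2 : ∑ i, |bucketSum h c (SparseCauchy.shadow U τ h *ᵥ x) i| ≤ u / 4 := by
      refine (sum_abs_bucketSum_mulVec_le h c _ hx1).trans ?_
      rw [one_mul]
      exact hc.shadow
    have h3 : u / 2 ≤ ∑ j ∈ heavyRows U τ, |c j * (U *ᵥ x) j| := by
      calc u / 2 ≤ u * ∑ j ∈ heavyRows U τ, |y j| := by nlinarith
        _ ≤ _ := by
          rw [Finset.mul_sum]
          refine Finset.sum_le_sum fun j hj => ?_
          rw [abs_mul]
          exact mul_le_mul_of_nonneg_right (hc.heavy j hj) (abs_nonneg _)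
    rw [← hy] at h1 h3
    linarith

lemma GoodWeights.lower_bound {U : Matrix (Fin n) (Fin d) ℝ}
    (hU : ∀ k, ∑ j, |U j k| ≤ 1)
    (hinf : ∀ (x : Fin d → ℝ) k, |x k| ≤ ∑ j, |(U *ᵥ x) j|) {τ z u B : ℝ} {M : ℕ}
    (hu0 : 0 ≤ u) (hu : u ≤ 1 / 16) (hM : 0 < M) (hMd : 4 * (d : ℝ) ≤ M) (hMB : 64 * B ≤ M)
    {h : Fin n → Fin s} (hh : GoodHash U τ z h)
    {c : Fin n → ℝ} (hc : GoodWeights U τ u B M h c) (x : Fin d → ℝ) :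
    u / 4 * ∑ j, |(U *ᵥ x) j| ≤ ∑ i, |bucketSum h c (U *ᵥ x) i| := by
  set T := ∑ j, |(U *ᵥ x) j| with hT
  have hT0 : 0 ≤ T := Finset.sum_nonneg fun _ _ => abs_nonneg _
  rcases hT0.eq_or_lt with h0 | h0
  · rw [← h0, mul_zero]
    exact Finset.sum_nonneg fun _ _ => abs_nonneg _
  · have h1 : ∑ j, |(U *ᵥ (T⁻¹ • x)) j| = 1 := by
      simp only [Matrix.mulVec_smul, Pi.smul_apply, smul_eq_mul, abs_mul, ← Finset.mul_sum]
      rw [abs_of_pos (inv_pos.2 h0), inv_mul_cancel₀ h0.ne']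
    have h2 := hc.lower_bound_of_norm_eq_one hU hinf hu0 hu hM hMd hMB hh h1
    have h3 : ∀ i, bucketSum h c (U *ᵥ (T⁻¹ • x)) i = T⁻¹ * bucketSum h c (U *ᵥ x) i := by
      intro i
      simp only [bucketSum, Matrix.mulVec_smul, Pi.smul_apply, smul_eq_mul, Finset.mul_sum]
      exact Finset.sum_congr rfl fun j _ => by ring
    simp_rw [h3, abs_mul, abs_of_pos (inv_pos.2 h0), ← Finset.mul_sum] at h2
    rwa [le_inv_mul_iff₀ h0, mul_comm] at h2

end Distortion

section Probability

lemma half_le_prod_of_sections {α β : Type*} [Finite α] [MeasurableSpace α]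
    [MeasurableSingletonClass α] [MeasurableSpace β] (μ : Measure α) (ν : Measure β)
    [IsProbabilityMeasure μ] [IsProbabilityMeasure ν] (G : Set α) (T : α → Set β)
    (hT : ∀ a, MeasurableSet (T a)) (hG : μ.real Gᶜ ≤ 3 / 20)
    (hGT : ∀ a ∈ G, ν.real (T a)ᶜ ≤ 3 / 10) :
    1 / 2 ≤ (μ.prod ν) {p | p.1 ∈ G ∧ p.2 ∈ T p.1} := by
  have hGm : MeasurableSet G := (Set.toFinite G).measurableSet
  have hS : MeasurableSet {p : α × β | p.1 ∈ G ∧ p.2 ∈ T p.1} := by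
    have : {p : α × β | p.1 ∈ G ∧ p.2 ∈ T p.1} = ⋃ a ∈ G, {a} ×ˢ T a := by
      ext p
      simp
    rw [this]
    exact MeasurableSet.biUnion (Set.to_countable G) fun a _ =>
      (measurableSet_singleton a).prod (hT a)
  rw [Measure.prod_apply hS]
  have hμG : ENNReal.ofReal (17 / 20) ≤ μ G := by
    rw [ENNReal.ofReal_le_iff_le_toReal (measure_ne_top _ _)]
    rw [probReal_compl_eq_one_sub hGm] at hG
    change _ ≤ μ.real G
    linarith
  have hνT : ∀ a ∈ G, ENNReal.ofReal (7 / 10) ≤ ν (T a) := by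
    intro a ha
    rw [ENNReal.ofReal_le_iff_le_toReal (measure_ne_top _ _)]
    have := hGT a ha
    rw [probReal_compl_eq_one_sub (hT a)] at this
    change _ ≤ ν.real (T a)
    linarith
  calc (1 / 2 : ENNReal) = ENNReal.ofReal (1 / 2) := by
        rw [ENNReal.ofReal_div_of_pos two_pos]; simp
    _ ≤ ENNReal.ofReal (7 / 10 * (17 / 20)) := ENNReal.ofReal_le_ofReal (by norm_num)
    _ = ENNReal.ofReal (7 / 10) * ENNReal.ofReal (17 / 20) := ENNReal.ofReal_mul (by norm_num)
    _ ≤ ENNReal.ofReal (7 / 10) * μ G := by gcongr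
    _ = ∫⁻ a, G.indicator (fun _ => ENNReal.ofReal (7 / 10)) a ∂μ := by
        rw [lintegral_indicator_const hGm]
    _ ≤ ∫⁻ a, ν (Prod.mk a ⁻¹' {p : α × β | p.1 ∈ G ∧ p.2 ∈ T p.1}) ∂μ := by
        refine lintegral_mono fun a => ?_
        by_cases ha : a ∈ G
        · rw [Set.indicator_of_mem ha]
          refine (hνT a ha).trans (measure_mono fun b hb => ⟨ha, hb⟩)
        · rw [Set.indicator_of_notMem ha]
          exact zero_le

/-- The embedding for admissible values of the heaviness threshold `τ`, the bound `u` on the heavy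
weights, the bound `z` on the shadow of the heavy rows, the truncation level `2 ^ t` and the
fineness `M` of the grid. -/
lemma half_le_sketchLaw_of_parameters {n d s : ℕ} (hs : 0 < s) (hd : 0 < d) {τ u z : ℝ} {M t : ℕ}
    (hτ : 0 < τ) (hu0 : 0 ≤ u) (hz : 0 < z) (hM : 0 < M)
    (h1 : 20 * (d / τ) ^ 2 ≤ s) (h2 : 20 * (d : ℝ) ^ 2 ≤ s * τ) (h3 : 20 * (d * (d / τ)) ≤ s * z)
    (ht : 20 * (s * d) ≤ 2 ^ t) (hud : 20 * (d / τ * u) ≤ 1) (hzu : 20 * (1 + t) * z ≤ u / 4)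
    (hnet : 20 * ((2 * M + 1 : ℝ) ^ d * Real.exp (-(1 / (6144 * τ)))) ≤ 1)
    (hu : u ≤ 1 / 16) (hMd : 4 * (d : ℝ) ≤ M) (hMB : 64 * (20 * (1 + t) * (d : ℝ)) ≤ M)
    {A : Matrix (Fin n) (Fin d) ℝ} (hA : A.rank = d) :
    1 / 2 ≤ sketchLaw s n {p | ∀ x : Fin d → ℝ,
      u / 4 * l1Norm (A *ᵥ x) ≤ l1Norm ((embeddingMatrix p.1 p.2 * A) *ᵥ x) ∧
      l1Norm ((embeddingMatrix p.1 p.2 * A) *ᵥ x) ≤ 20 * (1 + t) * d * l1Norm (A *ᵥ x)} := by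
  have : NeZero s := ⟨hs.ne'⟩
  obtain ⟨V, hV, hU, hinf⟩ := exists_auerbach_basis hA
  set U := A * V with hUdef
  refine le_trans (half_le_prod_of_sections (hashLaw s n) (cauchyPi (Fin n))
    {h | GoodHash U τ z h} (fun h => {c | GoodWeights U τ u (20 * (1 + t) * d) M h c})
    (fun h => measurableSet_goodWeights U τ u _ M h) (hashLaw_not_goodHash_le hU hτ hz h1 h2 h3)
    (fun h hh => cauchyPi_not_goodWeights_le hU hd hτ hu0 hz hM hh ht hud hzu hnet)) ?_
  refine measure_mono ?_
  rintro ⟨h, c⟩ ⟨hh, hc⟩ x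
  have hx : A *ᵥ x = U *ᵥ (V⁻¹ *ᵥ x) := by
    rw [hUdef, Matrix.mulVec_mulVec, Matrix.mul_assoc,
      Matrix.mul_nonsing_inv _ ((Matrix.isUnit_iff_isUnit_det V).1 hV), Matrix.mul_one]
  simp only
  rw [← Matrix.mulVec_mulVec, embeddingMatrix_mulVec, l1Norm_eq_sum_abs, l1Norm_eq_sum_abs, hx]
  exact ⟨GoodWeights.lower_bound hU hinf hu0 hu hM hMd hMB hh hc _,
    GoodWeights.upper_bound hinf hc _⟩

end Probability

section Dimension

lemma natClog_two_le {s : ℕ} (hs : 1 ≤ s) : (Nat.clog 2 s : ℝ) ≤ 3 / 2 * Real.log s + 1 := by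
  have hs' : (0 : ℝ) < s := by exact_mod_cast hs
  rcases Nat.eq_zero_or_pos (Nat.clog 2 s) with h0 | h0
  · rw [h0]
    have : 0 ≤ Real.log s := Real.log_natCast_nonneg s
    push_cast
    linarith
  · have h1 : 2 ^ (Nat.clog 2 s - 1) < s := Nat.pow_lt_of_lt_clog (by omega)
    have h2 : ((2 : ℝ) ^ (Nat.clog 2 s - 1)) ≤ s := by exact_mod_cast h1.le
    have h3 := Real.log_le_log (by positivity) h2
    rw [Real.log_pow, Nat.cast_sub h0] at h3
    have h4 := Real.log_two_gt_d9
    have h5 : (1 : ℝ) ≤ Nat.clog 2 s := by exact_mod_cast h0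
    push_cast at h3
    nlinarith

/-- The embedding in terms of `d` and `log s`. -/
lemma half_le_sketchLaw {n d s : ℕ} (hd : 1 ≤ d) (hq : 1 ≤ Real.log s)
    (hs : 6 * 10 ^ 13 * ((d : ℝ) ^ 5 * Real.log s ^ 3) ≤ s)
    {A : Matrix (Fin n) (Fin d) ℝ} (hA : A.rank = d) :
    1 / 2 ≤ sketchLaw s n {p | ∀ x : Fin d → ℝ,
      1 / (983040 * ((d : ℝ) ^ 2 * Real.log s)) * l1Norm (A *ᵥ x)
        ≤ l1Norm ((embeddingMatrix p.1 p.2 * A) *ᵥ x) ∧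
      l1Norm ((embeddingMatrix p.1 p.2 * A) *ᵥ x)
        ≤ 240 * (d * Real.log s) * l1Norm (A *ᵥ x)} := by
  set q := Real.log s with hqdef
  have hd' : (1 : ℝ) ≤ d := by exact_mod_cast hd
  have hq0 : 0 < q := by linarith
  have hd0 : (0 : ℝ) < d := by linarith
  have hmono : ∀ a b : ℕ, a ≤ 5 → b ≤ 3 → (d : ℝ) ^ a * q ^ b ≤ d ^ 5 * q ^ 3 := by
    intro a b ha hb
    gcongr
  have hdq : (1 : ℝ) ≤ d ^ 5 * q ^ 3 := by simpa using hmono 0 0 (by norm_num) (by norm_num)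
  have hs1 : (6 * 10 ^ 13 : ℝ) ≤ s := by nlinarith
  have hs0 : (0 : ℝ) < s := by linarith
  have hsN : 0 < s := by exact_mod_cast hs0
  have hsd : d ≤ s := by
    have h := hmono 1 0 (by norm_num) (by norm_num)
    have : (d : ℝ) ≤ s := by simp only [pow_one, pow_zero, mul_one] at h; nlinarith
    exact_mod_cast this
  set t := 5 + 2 * Nat.clog 2 s with htdef
  have ht : 20 * (s * d) ≤ 2 ^ t := by
    have h1 := Nat.le_pow_clog (b := 2) (by norm_num) s
    calc 20 * (s * d) ≤ 32 * (s * s) := by gcongr; norm_num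
      _ ≤ 32 * (2 ^ Nat.clog 2 s * 2 ^ Nat.clog 2 s) := by gcongr
      _ = 2 ^ t := by rw [htdef, pow_add, two_mul, pow_add]; norm_num
  have htq : (1 + t : ℝ) ≤ 12 * q := by
    have := natClog_two_le (s := s) hsN
    rw [htdef]
    push_cast
    linarith
  set M := (s - 1) / 2 with hMdef
  have hsM : s ≤ 2 * M + 2 := by omega
  have hMs : 2 * M + 1 ≤ s := by omega
  have hMr : (s : ℝ) / 4 ≤ M := by
    have : (s : ℝ) ≤ 2 * M + 2 := by exact_mod_cast hsM
    linarith
  have hM : 0 < M := by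
    have : (0 : ℝ) < M := by linarith
    exact_mod_cast this
  have hτ : (0 : ℝ) < 1 / (12288 * (d * q)) := by positivity
  have hdτ : (d : ℝ) / (1 / (12288 * (d * q))) = 12288 * (d ^ 2 * q) := by
    field_simp
  have hu0 : (0 : ℝ) < 1 / (245760 * (d ^ 2 * q)) := by positivity
  have hz : (0 : ℝ) < 245760 * (d ^ 3 * q) / s := by positivity
  have hnet : 20 * ((2 * M + 1 : ℝ) ^ d *
      Real.exp (-(1 / (6144 * (1 / (12288 * (d * q))))))) ≤ 1 := by
    have e1 : (1 : ℝ) / (6144 * (1 / (12288 * (d * q)))) = 2 * (d * q) := by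
      field_simp
      norm_num
    have e2 : (2 * M + 1 : ℝ) ^ d ≤ Real.exp (d * q) := by
      rw [Real.exp_nat_mul, hqdef, Real.exp_log hs0]
      gcongr
      exact_mod_cast hMs
    have e3 : (20 : ℝ) ≤ Real.exp (d * q) := by
      have h1 : q ≤ d * q := by nlinarith
      have h2 : (20 : ℝ) ≤ Real.exp q := by rw [hqdef, Real.exp_log hs0]; linarith
      exact h2.trans (Real.exp_le_exp.2 h1)
    rw [e1]
    calc _ ≤ Real.exp (d * q) * (Real.exp (d * q) * Real.exp (-(2 * (d * q)))) := by gcongr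
      _ = 1 := by rw [← Real.exp_add, ← Real.exp_add, ← Real.exp_zero]; congr 1; ring
  have m42 := hmono 4 2 (by norm_num) (by norm_num)
  have m31 := hmono 3 1 (by norm_num) (by norm_num)
  have m10 := hmono 1 0 (by norm_num) (by norm_num)
  have m11 := hmono 1 1 (by norm_num) (by norm_num)
  simp only [pow_one, pow_zero, mul_one] at m31 m10 m11
  refine le_trans (half_le_sketchLaw_of_parameters hsN hd (τ := 1 / (12288 * (d * q)))
    (u := 1 / (245760 * (d ^ 2 * q))) (z := 245760 * (d ^ 3 * q) / s) (M := M) (t := t)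
    hτ hu0.le hz hM ?_ ?_ ?_ ht ?_ ?_ hnet ?_ ?_ ?_ hA) (measure_mono ?_)
  · rw [hdτ]
    nlinarith
  · rw [mul_one_div, le_div_iff₀ (by positivity)]
    nlinarith
  · rw [hdτ]
    apply le_of_eq
    field_simp
    norm_num
  · rw [hdτ]
    apply le_of_eq
    field_simp
    norm_num
  · calc 20 * (1 + t : ℝ) * (245760 * (d ^ 3 * q) / s)
        ≤ 20 * (12 * q) * (245760 * (d ^ 3 * q) / s) := by gcongr
      _ = 58982400 * (d ^ 3 * q ^ 2) / s := by ring
      _ ≤ 1 / (983040 * (d ^ 2 * q)) := by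
          rw [div_le_div_iff₀ hs0 (by positivity)]
          nlinarith
      _ = _ := by field_simp; norm_num
  · rw [div_le_div_iff₀ (by positivity) (by norm_num)]
    have h1 : (1 : ℝ) ≤ d ^ 2 * q := by
      have : (1 : ℝ) ≤ d ^ 2 := one_le_pow₀ hd'
      nlinarith
    linarith
  · linarith
  · nlinarith
  · rintro ⟨h, c⟩ hp x
    obtain ⟨h1, h2⟩ := hp x
    refine ⟨le_trans (le_of_eq ?_) h1, h2.trans ?_⟩
    · congr 1
      field_simp
      norm_num
    · have h0 : 0 ≤ l1Norm (A *ᵥ x) := norm_nonneg _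
      refine mul_le_mul_of_nonneg_right ?_ h0
      nlinarith

lemma exists_log_cube_le (K : ℝ) (hK : 0 < K) :
    ∃ r₀ : ℝ, 1 ≤ r₀ ∧ ∀ r, r₀ ≤ r → K * Real.log r ^ 3 ≤ r := by
  have h := (Real.isLittleO_pow_log_id_atTop (n := 3)).bound (c := K⁻¹) (by positivity)
  obtain ⟨r₁, hr₁⟩ := Filter.eventually_atTop.1 h
  refine ⟨max r₁ 1, le_max_right _ _, fun r hr => ?_⟩
  have h1 := hr₁ r ((le_max_left _ _).trans hr)
  have hr1 : 1 ≤ r := (le_max_right _ _).trans hr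
  rw [id, Real.norm_of_nonneg (pow_nonneg (Real.log_nonneg hr1) 3),
    Real.norm_of_nonneg (by linarith), le_inv_mul_iff₀ hK] at h1
  exact h1

lemma log_natCast_ge {d : ℕ} (hd : 2 ≤ d) : (69 / 100 : ℝ) ≤ Real.log d := by
  have h1 : Real.log 2 ≤ Real.log d := Real.log_le_log two_pos (by exact_mod_cast hd)
  have := Real.log_two_gt_d9
  linarith

/-- The embedding dimension is admissible. -/
lemma exists_embeddingDim_admissible :
    ∃ ω₀ : ℝ, 1 ≤ ω₀ ∧ ∀ ω, ω₀ ≤ ω → ∀ d : ℕ, 2 ≤ d →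
      1 ≤ Real.log (embeddingDim ω d) ∧
      6 * 10 ^ 13 * ((d : ℝ) ^ 5 * Real.log (embeddingDim ω d) ^ 3) ≤ embeddingDim ω d := by
  obtain ⟨r₀, hr₀, hlog⟩ := exists_log_cube_le (5 * 10 ^ 14) (by norm_num)
  refine ⟨10 * r₀ + 2 * 10 ^ 17, by linarith, fun ω hω d hd => ?_⟩
  set s := embeddingDim ω d with hs
  set l := Real.log d with hl
  have hl1 : 69 / 100 ≤ l := log_natCast_ge hd
  have hd' : (2 : ℝ) ≤ d := by exact_mod_cast hd
  have hω0 : 0 < ω := by linarith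
  have hsge : ω * (d : ℝ) ^ 5 * l ^ 5 ≤ s := Nat.le_ceil _
  have hd5 : (0 : ℝ) < d ^ 5 := by positivity
  have hl5 : (1 / 10 : ℝ) ≤ l ^ 5 := by
    calc (1 / 10 : ℝ) ≤ (69 / 100) ^ 5 := by norm_num
      _ ≤ _ := by gcongr
  have hl2 : (4 / 10 : ℝ) ≤ l ^ 2 := by
    calc (4 / 10 : ℝ) ≤ (69 / 100) ^ 2 := by norm_num
      _ ≤ _ := by gcongr
  set r := (s : ℝ) / d ^ 5 with hr
  have hsr : (s : ℝ) = d ^ 5 * r := by rw [hr]; field_simp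
  have hrω : ω * l ^ 5 ≤ r := by
    rw [hr, le_div_iff₀ hd5]
    linarith
  have hrr₀ : r₀ ≤ r := by nlinarith
  have hr1 : 1 ≤ r := hr₀.trans hrr₀
  have hlogs : Real.log s = 5 * l + Real.log r := by
    rw [hsr, Real.log_mul hd5.ne' (by linarith), Real.log_pow]
    push_cast
    rfl
  have hlr0 : 0 ≤ Real.log r := Real.log_nonneg hr1
  rw [hlogs]
  refine ⟨by linarith, ?_⟩
  have hcube : (5 * l + Real.log r) ^ 3 ≤ 4 * (125 * l ^ 3 + Real.log r ^ 3) := by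
    nlinarith [mul_nonneg (add_nonneg (by linarith : 0 ≤ 5 * l) hlr0)
      (sq_nonneg (5 * l - Real.log r))]
  have h1 := hlog r hrr₀
  have h2 : 6 * 10 ^ 16 * l ^ 3 ≤ r := by
    have : l ^ 5 = l ^ 2 * l ^ 3 := by ring
    have hl3 : 0 ≤ l ^ 3 := by positivity
    calc 6 * 10 ^ 16 * l ^ 3 ≤ (ω * l ^ 2) * l ^ 3 := by
          refine mul_le_mul_of_nonneg_right ?_ hl3
          nlinarith
      _ ≤ r := by linarith
  rw [hsr]
  nlinarith

lemma log_embeddingDim_le {ω : ℝ} (hω : 1 ≤ ω) {d : ℕ} (hd : 2 ≤ d)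
    (hs : 1 ≤ Real.log (embeddingDim ω d)) :
    Real.log (embeddingDim ω d) ≤ (2 * Real.log (2 * ω) + 10) * Real.log d := by
  set s := embeddingDim ω d with hsdef
  have hl1 := log_natCast_ge hd
  have hd' : (2 : ℝ) ≤ d := by exact_mod_cast hd
  have hld : Real.log d ≤ d := (Real.log_le_sub_one_of_pos (by linarith)).trans (by linarith)
  have hs0 : (0 : ℝ) < s := by
    rcases Nat.eq_zero_or_pos s with h | h
    · rw [h] at hs
      norm_num at hs
    · exact_mod_cast h
  have hle : (s : ℝ) ≤ 2 * ω * d ^ 10 := by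
    have h1 : (s : ℝ) < ω * d ^ 5 * Real.log d ^ 5 + 1 := Nat.ceil_lt_add_one (by positivity)
    have h2 : ω * (d : ℝ) ^ 5 * Real.log d ^ 5 ≤ ω * d ^ 5 * d ^ 5 := by gcongr
    have h3 : (1 : ℝ) ≤ ω * d ^ 10 := by
      have : (1 : ℝ) ≤ d ^ 10 := one_le_pow₀ (by linarith)
      nlinarith
    have h4 : ω * (d : ℝ) ^ 5 * d ^ 5 = ω * d ^ 10 := by ring
    linarith
  have h1 := Real.log_le_log hs0 hle
  rw [Real.log_mul (by positivity) (by positivity), Real.log_pow] at h1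
  have h2 : 0 ≤ Real.log (2 * ω) := Real.log_nonneg (by linarith)
  push_cast at h1
  nlinarith

/-- The low-distortion embedding for `ℓ₁`. -/
theorem exists_low_distortion_embedding :
    ∃ ω₀ : ℝ, ∀ ω : ℝ, ω₀ ≤ ω → ∃ C₁ > (0 : ℝ), ∃ C₂ > (0 : ℝ),
      ∀ (n d : ℕ), 2 ≤ d → ∀ A : Matrix (Fin n) (Fin d) ℝ, A.rank = d →
        1 / 2 ≤ sketchLaw (embeddingDim ω d) n
          {p | ∀ x : Fin d → ℝ,
            1 / (C₁ * ((d : ℝ) ^ 2 * Real.log d ^ 2)) * l1Norm (A *ᵥ x) ≤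
                l1Norm ((embeddingMatrix p.1 p.2 * A) *ᵥ x) ∧
              l1Norm ((embeddingMatrix p.1 p.2 * A) *ᵥ x) ≤
                C₂ * ((d : ℝ) * Real.log d) * l1Norm (A *ᵥ x)} := by
  obtain ⟨ω₀, hω₀, hadm⟩ := exists_embeddingDim_admissible
  refine ⟨ω₀, fun ω hω => ?_⟩
  have hω1 : 1 ≤ ω := hω₀.trans hω
  have hlogω : 0 ≤ Real.log (2 * ω) := Real.log_nonneg (by linarith)
  set K := 2 * Real.log (2 * ω) + 10 with hK
  have hK0 : 0 < K := by positivity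
  refine ⟨983040 * (2 * K), by positivity, 240 * K, by positivity, fun n d hd A hA => ?_⟩
  obtain ⟨hq, hs⟩ := hadm ω hω d hd
  have hlog := log_embeddingDim_le hω1 hd hq
  have hl1 := log_natCast_ge hd
  have hd0 : (0 : ℝ) < d := by
    have : (2 : ℝ) ≤ d := by exact_mod_cast hd
    linarith
  refine (half_le_sketchLaw (by omega) hq hs hA).trans (measure_mono ?_)
  rintro ⟨h, c⟩ hp x
  obtain ⟨h1, h2⟩ := hp x
  have h0 : 0 ≤ l1Norm (A *ᵥ x) := norm_nonneg _
  refine ⟨le_trans (mul_le_mul_of_nonneg_right ?_ h0) h1,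
    h2.trans (mul_le_mul_of_nonneg_right ?_ h0)⟩
  · refine one_div_le_one_div_of_le (by positivity) ?_
    calc 983040 * ((d : ℝ) ^ 2 * Real.log (embeddingDim ω d))
        ≤ 983040 * ((d : ℝ) ^ 2 * (K * (2 * Real.log d ^ 2))) := by
          gcongr
          refine hlog.trans ?_
          gcongr
          nlinarith
      _ = _ := by ring
  · calc 240 * ((d : ℝ) * Real.log (embeddingDim ω d)) ≤ 240 * (d * (K * Real.log d)) := by gcongr
      _ = _ := by ring

end Dimension

open RealRAM

section Program

/-- The program which computes `Π A` in one pass over the triplets of `A`. Register `4` counts the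
triplets, register `5` holds `1` and register `6` the address of the output. -/
def productProgram : Program :=
  [.const 5 1, .add 6 3 0,
    .load 7 4, .add 8 3 4, .load 8 8, .add 9 3 3, .add 9 9 7, .load 9 9, .mul 9 9 1, .add 9 9 8,
    .add 9 6 9, .rload 0 4, .add 10 3 7, .rload 1 10, .rmul 0 0 1, .rload 1 9, .radd 0 0 1,
    .rstore 9 0, .add 4 4 5,
    .jumpLt 4 3 2]

lemma run_add (P : Program) (a b : ℕ) (σ : State) : run P (a + b) σ = run P b (run P a σ) := by
  rw [run, run, run, add_comm, Function.iterate_add_apply]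

/-- The address of the output entry to which the current triplet contributes. -/
def targetAddress (σ : State) : ℕ :=
  σ.I 6 + (σ.M (σ.I 3 + σ.I 3 + σ.M (σ.I 4)) * σ.I 1 + σ.M (σ.I 3 + σ.I 4))

/-- One round of the loop. -/
lemma run_loop (σ : State) (hpc : σ.pc = 2) :
    let τ := run productProgram 18 σ
    τ.I 1 = σ.I 1 ∧ τ.I 3 = σ.I 3 ∧ τ.I 4 = σ.I 4 + σ.I 5 ∧ τ.I 5 = σ.I 5 ∧
    τ.I 6 = σ.I 6 ∧ τ.M = σ.M ∧
    τ.X = Function.update σ.X (targetAddress σ)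
      (σ.X (σ.I 4) * σ.X (σ.I 3 + σ.M (σ.I 4)) + σ.X (targetAddress σ)) ∧
    τ.pc = if σ.I 4 + σ.I 5 < σ.I 3 then 2 else 20 := by
  obtain ⟨pc, I, M, R, X⟩ := σ
  obtain rfl : pc = 2 := hpc
  refine ⟨?_, ?_, ?_, ?_, ?_, ?_, ?_, ?_⟩ <;>
    simp [run, Function.iterate_succ, step, exec, productProgram, targetAddress]

end Program

section Correctness

variable {n d s : ℕ} (A : Matrix (Fin n) (Fin d) ℝ) (L : List (Fin n × Fin d))
  (h : Fin n → Fin s) (c : Fin n → ℝ)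

/-- The contribution of the triplet at position `p` to the entry `(i, k)` of `Π A`. -/
def contribution (i : Fin s) (k : Fin d) (p : Fin n × Fin d) : ℝ :=
  if h p.1 = i ∧ p.2 = k then A p.1 p.2 * c p.1 else 0

/-- The loop invariant: `r` triplets have been processed. -/
structure LoopInvariant (r : ℕ) (σ : State) : Prop where
  dim : σ.I 1 = d
  len : σ.I 3 = L.length
  counter : σ.I 4 = r
  one : σ.I 5 = 1
  base : σ.I 6 = L.length + n
  mem : σ.M = (inputState A L h c).M
  input : ∀ a < L.length + n, σ.X a = (inputState A L h c).X a
  output : ∀ (i : Fin s) (k : Fin d), σ.X (L.length + n + (i * d + k))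
    = ((L.take r).map (contribution A h c i k)).sum

lemma inputState_M_row {r : ℕ} (hr : r < L.length) :
    (inputState A L h c).M r = (L[r].1 : ℕ) := by
  simp [inputState, List.getD_eq_getElem?_getD, List.getElem?_append, hr]

lemma inputState_M_col {r : ℕ} (hr : r < L.length) :
    (inputState A L h c).M (L.length + r) = (L[r].2 : ℕ) := by
  simp [inputState, List.getD_eq_getElem?_getD, List.getElem?_append, hr]

lemma inputState_M_hash (j : Fin n) :
    (inputState A L h c).M (L.length + L.length + j) = (h j : ℕ) := by
  have h1 : ¬ L.length + L.length + j < L.length := by omega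
  have h2 : ¬ L.length + L.length + j - L.length < L.length := by omega
  have h3 : L.length + L.length + j - L.length - L.length = j := by omega
  simp [inputState, List.getD_eq_getElem?_getD, List.getElem?_append, h1, h2, h3]

lemma inputState_X_value {r : ℕ} (hr : r < L.length) :
    (inputState A L h c).X r = A L[r].1 L[r].2 := by
  simp [inputState, List.getD_eq_getElem?_getD, List.getElem?_append, hr]

lemma inputState_X_weight (j : Fin n) : (inputState A L h c).X (L.length + j) = c j := by
  simp [inputState, List.getD_eq_getElem?_getD, List.getElem?_append]

lemma inputState_X_output (a : ℕ) : (inputState A L h c).X (L.length + n + a) = 0 := by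
  have h1 : ¬ L.length + n + a < L.length := by omega
  have h2 : ¬ L.length + n + a - L.length < n := by omega
  simp [inputState, List.getD_eq_getElem?_getD, List.getElem?_append, h1, h2]

lemma rowMajor_injective {i i' k k' : ℕ} (hk : k < d) (hk' : k' < d)
    (he : i * d + k = i' * d + k') : i = i' ∧ k = k' := by
  have hd : 0 < d := by omega
  have h1 := congrArg (· / d) he
  have h2 := congrArg (· % d) he
  simp only [Nat.add_comm (_ * d), Nat.add_mul_div_right _ _ hd, Nat.div_eq_of_lt hk,
    Nat.div_eq_of_lt hk', Nat.add_mul_mod_self_right, Nat.mod_eq_of_lt hk,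
    Nat.mod_eq_of_lt hk', zero_add] at h1 h2
  exact ⟨h1, h2⟩

lemma loopInvariant_start :
    LoopInvariant A L h c 0 (run productProgram 2 (inputState A L h c)) ∧
      (run productProgram 2 (inputState A L h c)).pc = 2 := by
  have hX : (run productProgram 2 (inputState A L h c)).X = (inputState A L h c).X := rfl
  refine ⟨⟨?_, ?_, ?_, ?_, ?_, rfl, fun a _ => by rw [hX], fun i k => ?_⟩, rfl⟩
  · rfl
  · rfl
  · rfl
  · rfl
  · rfl
  · rw [hX, inputState_X_output]
    simp

lemma loopInvariant_step {r : ℕ} (hr : r < L.length) {σ : State} (hpc : σ.pc = 2)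
    (hσ : LoopInvariant A L h c r σ) :
    LoopInvariant A L h c (r + 1) (run productProgram 18 σ) ∧
      (run productProgram 18 σ).pc = if r + 1 < L.length then 2 else 20 := by
  obtain ⟨e1, e3, e4, e5, e6, eM, eX, epc⟩ := run_loop σ hpc
  have hrow : σ.M (σ.I 4) = (L[r].1 : ℕ) := by
    rw [hσ.mem, hσ.counter, inputState_M_row A L h c hr]
  have hcol : σ.M (σ.I 3 + σ.I 4) = (L[r].2 : ℕ) := by
    rw [hσ.mem, hσ.counter, hσ.len, inputState_M_col A L h c hr]
  have haddr : targetAddress σ = L.length + n + ((h L[r].1 : ℕ) * d + (L[r].2 : ℕ)) := by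
    rw [targetAddress, hrow, hcol, hσ.mem, hσ.len, inputState_M_hash, hσ.base, hσ.dim]
  have hval : σ.X (σ.I 4) = A L[r].1 L[r].2 := by
    rw [hσ.counter, hσ.input r (by omega), inputState_X_value A L h c hr]
  have hwt : σ.X (σ.I 3 + σ.M (σ.I 4)) = c L[r].1 := by
    rw [hrow, hσ.len, hσ.input _ (by have := L[r].1.isLt; omega), inputState_X_weight]
  rw [hval, hwt, haddr, hσ.output] at eX
  refine ⟨⟨by rw [e1, hσ.dim], by rw [e3, hσ.len], by rw [e4, hσ.counter, hσ.one],
    by rw [e5, hσ.one], by rw [e6, hσ.base], by rw [eM, hσ.mem], fun a ha => ?_, fun i k => ?_⟩,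
    by rw [epc, hσ.counter, hσ.one, hσ.len]⟩
  · rw [eX, Function.update_of_ne (by omega), hσ.input a ha]
  · rw [eX, List.take_add_one, List.getElem?_eq_getElem hr]
    simp only [Option.toList_some, List.map_append, List.map_cons, List.map_nil, List.sum_append,
      List.sum_cons, List.sum_nil, add_zero]
    by_cases hik : h L[r].1 = i ∧ L[r].2 = k
    · obtain ⟨rfl, rfl⟩ := hik
      rw [Function.update_self, contribution, if_pos ⟨rfl, rfl⟩, add_comm]
    · rw [Function.update_of_ne, hσ.output, contribution, if_neg hik, add_zero]
      intro he
      obtain ⟨g1, g2⟩ := rowMajor_injective k.isLt L[r].2.isLt (Nat.add_left_cancel he)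
      exact hik ⟨(Fin.ext g1).symm, (Fin.ext g2).symm⟩

lemma loopInvariant_run {r : ℕ} (hr : r ≤ L.length) (hL : 0 < L.length) :
    LoopInvariant A L h c r (run productProgram (2 + 18 * r) (inputState A L h c)) ∧
      (run productProgram (2 + 18 * r) (inputState A L h c)).pc
        = if r < L.length then 2 else 20 := by
  induction r with
  | zero => simpa [hL] using loopInvariant_start A L h c
  | succ r ih =>
    obtain ⟨h1, h2⟩ := ih (by omega)
    rw [if_pos (by omega)] at h2
    rw [show 2 + 18 * (r + 1) = (2 + 18 * r) + 18 by ring, run_add]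
    exact loopInvariant_step A L h c (by omega) h2 h1

variable {A L}

lemma IsSupportList.nnz_eq_length (hL : IsSupportList A L) : nnz A = L.length := by
  have : {p : Fin n × Fin d | A p.1 p.2 ≠ 0} = (L.toFinset : Set (Fin n × Fin d)) := by
    ext p
    simp [hL.2 p]
  rw [nnz, this, Set.ncard_coe_finset, List.toFinset_card_of_nodup hL.1]

lemma IsSupportList.sum_contribution (hL : IsSupportList A L) (i : Fin s) (k : Fin d) :
    (L.map (contribution A h c i k)).sum = (embeddingMatrix h c * A) i k := by
  rw [← List.sum_toFinset _ hL.1, Finset.sum_subset (Finset.subset_univ _)]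
  · rw [Fintype.sum_prod_type, Matrix.mul_apply]
    refine Finset.sum_congr rfl fun j _ => ?_
    rw [embeddingMatrix, Matrix.mul_diagonal]
    by_cases hj : h j = i
    · simp [contribution, hashMatrix, hj, mul_comm]
    · simp [contribution, hashMatrix, hj]
  · intro p _ hp
    have : A p.1 p.2 = 0 := by
      by_contra hne
      exact hp (List.mem_toFinset.2 ((hL.2 p).2 hne))
    simp [contribution, this]

lemma IsSupportList.length_pos (hL : IsSupportList A L) (hd : 1 ≤ d) (hA : A.rank = d) :
    0 < L.length := by
  rw [List.length_pos_iff]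
  rintro rfl
  have : A = 0 := by
    ext j k
    by_contra hne
    simpa using (hL.2 (j, k)).2 hne
  rw [this, Matrix.rank_zero] at hA
  omega

/-- The product `Π A` is computed in time proportional to the number of nonzero entries of `A`. -/
lemma computesProductWithin_productProgram (hL : IsSupportList A L) (hd : 1 ≤ d)
    (hA : A.rank = d) : ComputesProductWithin productProgram (20 * nnz A) A L h c := by
  have hpos := hL.length_pos hd hA
  obtain ⟨h1, h2⟩ := loopInvariant_run A L h c le_rfl hpos
  refine ⟨2 + 18 * L.length, by rw [hL.nnz_eq_length]; omega, ?_, fun i k => ?_⟩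
  · rw [Halted, h2, if_neg (lt_irrefl _)]
    decide
  · rw [h1.output, List.take_length, hL.sum_contribution]

end Correctness

end SparseCauchy

end

theorem theorem2 :
    (∃ ω₀ : ℝ, ∀ ω : ℝ, ω₀ ≤ ω → ∃ C₁ > (0 : ℝ), ∃ C₂ > (0 : ℝ),
      ∀ (n d : ℕ), 2 ≤ d → ∀ A : Matrix (Fin n) (Fin d) ℝ, A.rank = d →
        1 / 2 ≤ SparseCauchy.sketchLaw (SparseCauchy.embeddingDim ω d) n
          {p | ∀ x : Fin d → ℝ,
            1 / (C₁ * ((d : ℝ) ^ 2 * Real.log d ^ 2)) * SparseCauchy.l1Norm (A *ᵥ x) ≤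
                SparseCauchy.l1Norm ((SparseCauchy.embeddingMatrix p.1 p.2 * A) *ᵥ x) ∧
              SparseCauchy.l1Norm ((SparseCauchy.embeddingMatrix p.1 p.2 * A) *ᵥ x) ≤
                C₂ * ((d : ℝ) * Real.log d) * SparseCauchy.l1Norm (A *ᵥ x)}) ∧
    (∃ (P : RealRAM.Program) (K : ℕ),
      ∀ (n d s : ℕ), 1 ≤ d → ∀ A : Matrix (Fin n) (Fin d) ℝ, A.rank = d →
        ∀ L : List (Fin n × Fin d), SparseCauchy.IsSupportList A L →
          ∀ (h : Fin n → Fin s) (c : Fin n → ℝ),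
            SparseCauchy.ComputesProductWithin P (K * SparseCauchy.nnz A) A L h c) :=
  ⟨SparseCauchy.exists_low_distortion_embedding, SparseCauchy.productProgram, 20,
    fun _ _ _ hd _ hA _ hL h c => SparseCauchy.computesProductWithin_productProgram h c hL hd hA⟩
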